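/- Let $N$ be a finite set, identify $(\mathbb R^N)^*$ with the space of vectors $x=(x_i)_{i\in N}$ via the basis $(e_i)_{i\in N}$, and write $x(S)=\sum_{i\in S}x_i$ for $S\subseteq N$. Let $\mathbb A_N=\{\pm e_i,\ e_i-e_j : i,j\in N\}$; an $\mathbb A_N$-flat is a linear subspace spanned by a subset of $\mathbb A_N$. An $\mathbb A_N$-polyhedron is a polyhedron $P$ (the solution set of finitely many non-strict linear inequalities) such that for every non-empty face $F$ of $P$ (including $P$ itself) the tangent space $\mathbb R(F-F)$ is an $\mathbb A_N$-flat; it is an $\mathbb A_N$-polytope if it is the convex hull of a finite set. A polyhedron is integer if it is given by finitely many linear inequalities with integer coefficients and integer right-hand sides and each of its non-empty faces contains a point with integer coordinates. A strong pair $(b,a)$ consists of a submodular function $b:2^N\to\mathbb R\cup\{+\infty\}$ and a supermodular function $a:2^N\to\mathbb R\cup\{-\infty\}$ with $b(\emptyset)=a(\emptyset)=0$ and $$b(S)-a(T)\ \ge\ b(S\setminus T)-a(T\setminus S)\qquad (S,T\subseteq N).$$ A generalized polymatroid is a set of the form $Q(b,a)=\{x : a(S)\le x(S)\le b(S)\ \text{for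 all } S\subseteq N\}$ with $(b,a)$ a strong pair; it is an integer generalized polymatroid if $(b,a)$ can be chosen so that all finite values of $b$ and $a$ are integers. Then: 1. The class of generalized polymatroids coincides with the class of non-empty $\mathbb A_N$-polyhedra. 2. The class of bounded generalized polymatroids coincides with the class of non-empty $\mathbb A_N$-polytopes. 3. The class of integer generalized polymatroids coincides with the class of non-empty integer $\mathbb A_N$-polyhedra. 4. The class of bounded integer generalized polymatroids coincides with the class of non-empty integer $\mathbb A_N$-polytopes. 5. For every non-empty $\mathbb A_N$-polyhedron $P$, the functions $b_P(S)=\sup_{x\in P}x(S)$ and $a_P(S)=\inf_{x\in P}x(S)$ form a strong pair, and $Q(b_P,a_P)=P$. 6. For every strong pair $(b,a)$, the polyhedron $P=Q(b,a)$ satisfies $b_P=b$ and $a_P=a$; it is bounded if and only if $b$ and $a$ have only finite values, and it is an integer polyhedron if and only if all finite values of $b$ and $a$ are integers. -/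

import Mathlib

open scoped Pointwise

namespace DiscreteConvexity

/-! The space `(ℝ^N)^*` of (signed) measures on the finite set `N` is written in coordinates with
respect to the basis `e_i = Pi.single i 1`: a measure `x` is the vector `x : N → ℝ` of its values
on points, its value on a subset is `meas x S`, and the integer points are the vectors with
integer coordinates. -/

/-! ### Polyhedra, faces, polytopes, integer polyhedra -/

/-- A polyhedron: the solution set of a finite system of linear inequalities `p v ≤ c`. -/
def IsPolyhedron {V : Type*} [AddCommGroup V] [Module ℝ V] (P : Set V) : Prop :=
  ∃ s : Finset (Module.Dual ℝ V × ℝ), P = {v | ∀ c ∈ s, c.1 v ≤ c.2}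

/-- A polytope: the convex hull of a finite set of points. -/
def IsPolytope {V : Type*} [AddCommGroup V] [Module ℝ V] (P : Set V) : Prop :=
  ∃ s : Finset V, P = convexHull ℝ (s : Set V)

/-- A (non-empty) face of `P`: the non-empty set of maximizers over `P` of a linear functional.
The functional `0` gives `P` itself. -/
def IsFace {V : Type*} [AddCommGroup V] [Module ℝ V] (P F : Set V) : Prop :=
  F.Nonempty ∧ ∃ p : Module.Dual ℝ V, F = {x | x ∈ P ∧ ∀ y ∈ P, p y ≤ p x}

/-- The tangent space `ℝ(F - F)`. -/
def tangentSpace {V : Type*} [AddCommGroup V] [Module ℝ V] (F : Set V) : Submodule ℝ V :=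
  Submodule.span ℝ (F - F)

/-- `P` is a `U`-polyhedron: a polyhedron all of whose faces have their tangent space in `U`. -/
def IsUPolyhedron {V : Type*} [AddCommGroup V] [Module ℝ V] (U : Set (Submodule ℝ V))
    (P : Set V) : Prop :=
  IsPolyhedron P ∧ ∀ F : Set V, IsFace P F → tangentSpace F ∈ U

/-- The flats of a set of vectors `R`: the subspaces spanned by the subsets of `R`. -/
def flats {V : Type*} [AddCommGroup V] [Module ℝ V] (R : Set V) : Set (Submodule ℝ V) :=
  {L | ∃ B : Set V, B ⊆ R ∧ L = Submodule.span ℝ B}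

/-- A rational polyhedron: given by finitely many inequalities `∑ i, p i * x i ≤ c` with integer
`p` and `c`. -/
def IsRationalPolyhedron {N : Type*} [Fintype N] (P : Set (N → ℝ)) : Prop :=
  ∃ s : Finset ((N → ℤ) × ℤ), P = {x | ∀ c ∈ s, ∑ i, (c.1 i : ℝ) * x i ≤ (c.2 : ℝ)}

/-- An integer polyhedron: a rational polyhedron, every non-empty face of which contains an
integer point. -/
def IsIntegerPolyhedron {N : Type*} [Fintype N] (P : Set (N → ℝ)) : Prop :=
  IsRationalPolyhedron P ∧
    ∀ F : Set (N → ℝ), IsFace P F → ∃ z : N → ℤ, (fun i => (z i : ℝ)) ∈ F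

/-! ### The system `𝔸_N` -/

/-- The set `𝔸_N` of the vectors `± e_i` and `e_i - e_j`, `i, j ∈ N`. -/
def rootsA (N : Type*) [DecidableEq N] : Set (N → ℝ) :=
  {r | (∃ i, r = Pi.single i 1) ∨ (∃ i, r = -Pi.single i 1) ∨
    ∃ i j, r = Pi.single i 1 - Pi.single j 1}

/-- `𝔸_N`-polyhedra. -/
def IsANPolyhedron {N : Type*} [DecidableEq N] (P : Set (N → ℝ)) : Prop :=
  IsUPolyhedron (flats (rootsA N)) P

/-- `𝔸_N`-polytopes. -/
def IsANPolytope {N : Type*} [DecidableEq N] (P : Set (N → ℝ)) : Prop :=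
  IsPolytope P ∧ IsANPolyhedron P

/-! ### Strong pairs and generalized polymatroids -/

/-- The value `x(S)` of the measure `x` on the set `S`. -/
def meas {N : Type*} (x : N → ℝ) (S : Finset N) : ℝ := ∑ i ∈ S, x i

/-- A strong pair `(b, a)`: a submodular `b : 2^N → ℝ ∪ {+∞}` and a supermodular
`a : 2^N → ℝ ∪ {-∞}`, both zero at the empty set, linked by the cross inequality. Because `b`
avoids `-∞` and `a` avoids `+∞`, no expression `∞ - ∞` occurs below. -/
structure IsStrongPair {N : Type*} [DecidableEq N] (b a : Finset N → EReal) : Prop where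
  b_ne_bot : ∀ S, b S ≠ ⊥
  a_ne_top : ∀ S, a S ≠ ⊤
  b_empty : b ∅ = 0
  a_empty : a ∅ = 0
  submodular : ∀ S T, b (S ∪ T) + b (S ∩ T) ≤ b S + b T
  supermodular : ∀ S T, a S + a T ≤ a (S ∪ T) + a (S ∩ T)
  cross : ∀ S T, b (S \ T) - a (T \ S) ≤ b S - a T

/-- The finite values of `b` and `a` are integers. -/
def IsIntegerValuedPair {N : Type*} (b a : Finset N → EReal) : Prop :=
  (∀ S, b S = ⊤ ∨ ∃ z : ℤ, b S = ((z : ℝ) : EReal)) ∧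
    ∀ S, a S = ⊥ ∨ ∃ z : ℤ, a S = ((z : ℝ) : EReal)

/-- The set of all `x` with `a(S) ≤ x(S) ≤ b(S)` for all `S ⊆ N`. -/
def gpoly {N : Type*} (b a : Finset N → EReal) : Set (N → ℝ) :=
  {x | ∀ S : Finset N, a S ≤ (meas x S : EReal) ∧ (meas x S : EReal) ≤ b S}

/-- Generalized polymatroids. -/
def IsGPolymatroid {N : Type*} [DecidableEq N] (P : Set (N → ℝ)) : Prop :=
  ∃ b a : Finset N → EReal, IsStrongPair b a ∧ P = gpoly b a

/-- Integer generalized polymatroids: those given by an integer-valued strong pair. -/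
def IsIntegerGPolymatroid {N : Type*} [DecidableEq N] (P : Set (N → ℝ)) : Prop :=
  ∃ b a : Finset N → EReal, IsStrongPair b a ∧ IsIntegerValuedPair b a ∧ P = gpoly b a

/-- `b_P(S) = sup {x(S) | x ∈ P}`, the value at `1_S` of the support function of `P`. -/
noncomputable def upperFn {N : Type*} (P : Set (N → ℝ)) (S : Finset N) : EReal :=
  ⨆ x ∈ P, (meas x S : EReal)

/-- `a_P(S) = inf {x(S) | x ∈ P}`, minus the value at `-1_S` of the support function of `P`. -/
noncomputable def lowerFn {N : Type*} (P : Set (N → ℝ)) (S : Finset N) : EReal :=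
  ⨅ x ∈ P, (meas x S : EReal)

end DiscreteConvexity

/-! From polyhedra to pairs, everything rests on `IsUPolyhedron.exists_common_max`: functionals that
never take opposite signs on a root can be maximized at one point. The pairs `1_{S ∪ T}, 1_{S ∩ T}`
and `1_{S \ T}, -1_{T \ S}` qualify. Evaluating `x(S ∪ T) + x(S ∩ T) = x(S) + x(T)` at a common
maximizer `x` gives submodularity, and the other two axioms follow in the same way. Any functional
splits into sign-compatible multiples of `± 1_S`, so the bounds on all `x(S)` already cut out `P`
(`IsANPolyhedron.exists_dotDual_le`).

Conversely, adjoin a point `none` to `N` and extend `x` so that its total is zero. The pair `(b, a)`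
becomes one submodular function `pairFn`, finite on a ring of sets, and the three axioms are the
cases of submodularity according to which sets contain `none`. Extending it to a finite submodular
function that is large off the ring (`IsSubmodularOn.exists_extension`), the greedy algorithm
(`exists_greedy`) produces points of `Q(b, a)`. These show non-emptiness, sharpness of all bounds,
and integrality when the data are integers. The sets tight on a face form a ring, whose annihilator
is spanned by differences `e_i - e_j` (`mem_span_of_forall_meas_eq_zero`); deleting the coordinate
`none` turns these into roots or zero. -/

namespace DiscreteConvexity

/-! ### Linear inequalities, faces and common maximizers -/

section Polyhedra

variable {V : Type*} [AddCommGroup V] [Module ℝ V]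

/-- The solution set of a finite system of linear inequalities. -/
def solutionSet (s : Finset (Module.Dual ℝ V × ℝ)) : Set V := {v | ∀ c ∈ s, c.1 v ≤ c.2}

/-- The constraints of the system `s` that hold with equality at `x`. -/
noncomputable def tight (s : Finset (Module.Dual ℝ V × ℝ)) (x : V) :
    Finset (Module.Dual ℝ V × ℝ) :=
  open Classical in s.filter fun c => c.1 x = c.2

lemma mem_tight {s : Finset (Module.Dual ℝ V × ℝ)} {x : V} {c : Module.Dual ℝ V × ℝ} :
    c ∈ tight s x ↔ c ∈ s ∧ c.1 x = c.2 := by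
  simp [tight]

/-- Constraints slack at `x` survive a short step by continuity, so only the tight ones restrict the
direction. -/
lemma exists_small_step {s : Finset (Module.Dual ℝ V × ℝ)} {x v : V} (hx : x ∈ solutionSet s)
    (hv : ∀ c ∈ tight s x, c.1 v ≤ 0) : ∃ ε : ℝ, 0 < ε ∧ x + ε • v ∈ solutionSet s := by
  have h : ∀ᶠ t : ℝ in nhdsWithin 0 (Set.Ioi 0), ∀ c ∈ s, c.1 (x + t • v) ≤ c.2 := by
    rw [Filter.eventually_all_finset]
    intro c hc
    rcases (hx c hc).eq_or_lt with h | h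
    · filter_upwards [self_mem_nhdsWithin] with t ht
      have := hv c (mem_tight.2 ⟨hc, h⟩)
      simp only [map_add, map_smul, smul_eq_mul]
      nlinarith [Set.mem_Ioi.1 ht]
    · have hcont : Continuous fun t : ℝ => c.1 x + t * c.1 v := by fun_prop
      have : ∀ᶠ t : ℝ in nhds 0, c.1 x + t * c.1 v < c.2 :=
        hcont.continuousAt.eventually_lt continuousAt_const (by simpa using h)
      filter_upwards [nhdsWithin_le_nhds this] with t ht
      simpa using ht.le
  obtain ⟨ε, h1, h2⟩ := (h.and self_mem_nhdsWithin).exists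
  exact ⟨ε, h2, h1⟩

/-- Moving from `x` in a direction that leaves the polyhedron, one stops at a point where a further
constraint is tight. -/
lemma exists_blocking_step {s : Finset (Module.Dual ℝ V × ℝ)} {x v : V} (hx : x ∈ solutionSet s)
    (hv : ∃ c ∈ s, 0 < c.1 v) :
    ∃ t : ℝ, 0 ≤ t ∧ x + t • v ∈ solutionSet s ∧ ∃ c ∈ s, 0 < c.1 v ∧ c.1 (x + t • v) = c.2 := by
  classical
  obtain ⟨c₁, hc₁, hc₁v⟩ := hv
  -- Ratio test: the first constraint met is the one with the least quotient of slack by speed.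
  obtain ⟨c₀, hc₀, hmin⟩ := (s.filter fun c => 0 < c.1 v).exists_min_image
    (fun c => (c.2 - c.1 x) / c.1 v) ⟨c₁, by simp [hc₁, hc₁v]⟩
  rw [Finset.mem_filter] at hc₀
  have h0 : 0 ≤ (c₀.2 - c₀.1 x) / c₀.1 v :=
    div_nonneg (sub_nonneg.2 (hx c₀ hc₀.1)) hc₀.2.le
  refine ⟨_, h0, fun c hc => ?_, c₀, hc₀.1, hc₀.2, ?_⟩
  · simp only [map_add, map_smul, smul_eq_mul]
    rcases le_or_gt (c.1 v) 0 with h | h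
    · have := hx c hc
      nlinarith [mul_nonneg h0 (neg_nonneg.2 h)]
    · have := hmin c (by simp [hc, h])
      rw [le_div_iff₀ h] at this
      linarith
  · have := hc₀.2.ne'
    simp only [map_add, map_smul, smul_eq_mul]
    field_simp
    ring

/-- Among the points at least as good as `x`, take one with the most tight constraints. A direction
that keeps these tight and increases `p` would meet a further constraint or give a ray on which `p`
is unbounded. -/
lemma exists_le_of_bddAbove {s : Finset (Module.Dual ℝ V × ℝ)} {p : Module.Dual ℝ V}
    (hp : BddAbove (p '' solutionSet s)) {x : V} (hx : x ∈ solutionSet s) :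
    ∃ y ∈ solutionSet s, p x ≤ p y ∧ ∀ v, (∀ c ∈ tight s y, c.1 v = 0) → p v = 0 := by
  obtain ⟨y, ⟨hy, hxy⟩, hmin⟩ := (measure fun y => s.card - (tight s y).card).wf.has_min
    {y | y ∈ solutionSet s ∧ p x ≤ p y} ⟨x, hx, le_rfl⟩
  refine ⟨y, hy, hxy, ?_⟩
  have key : ∀ v, (∀ c ∈ tight s y, c.1 v = 0) → ¬ 0 < p v := by
    intro v hv hpv
    by_cases hex : ∃ c ∈ s, 0 < c.1 v
    · obtain ⟨t, ht, hmem, c, hc, hcv, hct⟩ := exists_blocking_step hy hex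
      refine hmin (y + t • v) ⟨hmem, ?_⟩ ?_
      · simp only [map_add, map_smul, smul_eq_mul]
        nlinarith [mul_nonneg ht hpv.le]
      · have hsub : tight s y ⊂ tight s (y + t • v) := by
          refine Finset.ssubset_iff_of_subset (fun d hd => ?_) |>.2
            ⟨c, mem_tight.2 ⟨hc, hct⟩, fun h => hcv.ne' (hv c h)⟩
          have := mem_tight.1 hd
          exact mem_tight.2 ⟨this.1, by simp [hv d hd, this.2]⟩
        have h1 := Finset.card_lt_card hsub
        have h2 : (tight s (y + t • v)).card ≤ s.card :=
          Finset.card_le_card fun d hd => (mem_tight.1 hd).1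
        change s.card - _ < s.card - _
        omega
    · push Not at hex
      obtain ⟨C, hC⟩ := hp
      have hray : ∀ t : ℝ, 0 ≤ t → p y + t * p v ≤ C := by
        intro t ht
        have : y + t • v ∈ solutionSet s := by
          intro c hc
          have h1 := hex c hc
          have h2 := hy c hc
          simp only [map_add, map_smul, smul_eq_mul]
          nlinarith
        simpa using hC ⟨_, this, rfl⟩
      have h0 := hray 0 le_rfl
      have h1 := hray ((C - p y + 1) / p v) (by apply div_nonneg <;> linarith)
      rw [div_mul_cancel₀ _ hpv.ne'] at h1
      linarith
  intro v hv
  have h1 := key v hv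
  have h2 := key (-v) (by simpa using hv)
  simp only [map_neg] at h2
  linarith

/-- A linear functional bounded above on a non-empty polyhedron attains its maximum. -/
lemma IsPolyhedron.exists_isMax {P : Set V} (hP : IsPolyhedron P) (hne : P.Nonempty)
    {p : Module.Dual ℝ V} (hp : BddAbove (p '' P)) : ∃ x ∈ P, ∀ y ∈ P, p y ≤ p x := by
  obtain ⟨s, rfl⟩ := hP
  change ∃ x ∈ solutionSet s, ∀ y ∈ solutionSet s, p y ≤ p x
  -- On `W` the value of `p` depends only on the set of tight constraints, so it takes finitely many
  -- values; every point is dominated by one of `W`.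
  set W : Set V := {y | y ∈ solutionSet s ∧ ∀ v, (∀ c ∈ tight s y, c.1 v = 0) → p v = 0} with hW
  have hfin : (p '' W).Finite := by
    have hinj : ∀ y ∈ W, ∀ z ∈ W, tight s y = tight s z → p y = p z := by
      intro y hy z hz h
      rw [← sub_eq_zero, ← map_sub]
      refine hy.2 _ fun c hc => ?_
      rw [map_sub, (mem_tight.1 hc).2, (mem_tight.1 (h ▸ hc)).2, sub_self]
    refine Set.Finite.subset ((s.powerset.finite_toSet).image
      fun t => open Classical in if h : ∃ y ∈ W, tight s y = t then p h.choose else 0) ?_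
    rintro _ ⟨y, hy, rfl⟩
    have hex : ∃ z ∈ W, tight s z = tight s y := ⟨y, hy, rfl⟩
    refine ⟨tight s y, Finset.mem_coe.2 <|
      Finset.mem_powerset.2 fun d hd => (mem_tight.1 hd).1, ?_⟩
    dsimp only
    rw [dif_pos hex]
    exact hinj _ hex.choose_spec.1 _ hy hex.choose_spec.2
  obtain ⟨x₀, hx₀⟩ := hne
  obtain ⟨y₀, hy₀, -, hy₀'⟩ := exists_le_of_bddAbove hp hx₀
  obtain ⟨_, ⟨x, hx, rfl⟩, hmax⟩ := Set.exists_max_image _ id hfin ⟨p y₀, y₀, ⟨hy₀, hy₀'⟩, rfl⟩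
  refine ⟨x, hx.1, fun y hy => ?_⟩
  obtain ⟨z, hz, hyz, hz'⟩ := exists_le_of_bddAbove hp hy
  exact hyz.trans (hmax _ ⟨z, ⟨hz, hz'⟩, rfl⟩)

lemma map_eq_zero_of_mem_tangentSpace {F : Set V} {p : Module.Dual ℝ V}
    (h : ∀ x ∈ F, ∀ y ∈ F, p x = p y) {v : V} (hv : v ∈ tangentSpace F) : p v = 0 := by
  have : tangentSpace F ≤ LinearMap.ker p := by
    refine Submodule.span_le.2 ?_
    rintro _ ⟨x, hx, y, hy, rfl⟩
    simp [h x hx y hy]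
  exact this hv

/-- Every vector on which the constraints tight on a whole face vanish is tangent to the face. -/
lemma mem_tangentSpace_of_forall_tight {s : Finset (Module.Dual ℝ V × ℝ)} {F : Set V}
    (hF : IsFace (solutionSet s) F) {v : V}
    (hv : ∀ c ∈ s, (∀ x ∈ F, c.1 x = c.2) → c.1 v = 0) : v ∈ tangentSpace F := by
  obtain ⟨hne, p, hp⟩ := hF
  -- A point with the fewest tight constraints plays the role of a relative interior point: a
  -- constraint tight there but slack at some `y ∈ F` would be lost at the midpoint.
  obtain ⟨x, hx, hmin⟩ := (measure fun y => (tight s y).card).wf.has_min F hne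
  have hFP : ∀ y ∈ F, y ∈ solutionSet s := fun y hy => by rw [hp] at hy; exact hy.1
  have htight : ∀ c ∈ tight s x, ∀ y ∈ F, c.1 y = c.2 := by
    intro c hc y hy
    by_contra hne'
    have hcs := (mem_tight.1 hc).1
    have hlt : c.1 y < c.2 := lt_of_le_of_ne (hFP y hy c hcs) hne'
    set z : V := (1 / 2 : ℝ) • x + (1 / 2 : ℝ) • y with hz
    have hzv : ∀ q : Module.Dual ℝ V, q z = (q x + q y) / 2 := by
      intro q
      simp only [hz, map_add, map_smul, smul_eq_mul]
      ring
    have hzP : z ∈ solutionSet s := fun d hd => by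
      have h1 := hFP x hx d hd
      have h2 := hFP y hy d hd
      rw [hzv]
      linarith
    have hzF : z ∈ F := by
      rw [hp] at hx hy ⊢
      refine ⟨hzP, fun w hw => ?_⟩
      have h1 := hx.2 w hw
      have h2 := hy.2 w hw
      rw [hzv]
      linarith
    refine hmin z hzF (Finset.card_lt_card ?_)
    refine Finset.ssubset_iff_of_subset (fun d hd => ?_) |>.2 ⟨c, hc, fun h => ?_⟩
    · obtain ⟨hd1, hd2⟩ := mem_tight.1 hd
      have h1 := hFP x hx d hd1
      have h2 := hFP y hy d hd1
      rw [hzv] at hd2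
      exact mem_tight.2 ⟨hd1, by linarith⟩
    · have h1 := (mem_tight.1 h).2
      have h2 := (mem_tight.1 hc).2
      rw [hzv] at h1
      linarith
  have hv0 : ∀ c ∈ tight s x, c.1 v = 0 := fun c hc => hv c (mem_tight.1 hc).1 (htight c hc)
  obtain ⟨ε, hε, h1⟩ := exists_small_step (hFP x hx) fun c hc => (hv0 c hc).le
  obtain ⟨δ, hδ, h2⟩ := exists_small_step (v := -v) (hFP x hx) fun c hc => by simp [hv0 c hc]
  have hx' := hx
  rw [hp] at hx'
  have hpv : p v = 0 := by
    have h3 := hx'.2 _ h1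
    have h4 := hx'.2 _ h2
    simp only [map_add, map_smul, smul_eq_mul, map_neg] at h3 h4
    nlinarith
  have hmem : x + ε • v ∈ F := by
    rw [hp]
    exact ⟨h1, fun y hy => by simpa [hpv] using hx'.2 y hy⟩
  have : ε • v ∈ tangentSpace F :=
    Submodule.subset_span ⟨_, hmem, x, hx, by simp⟩
  simpa [smul_smul, inv_mul_cancel₀ hε.ne'] using (tangentSpace F).smul_mem ε⁻¹ this

/-- On a polyhedron whose faces have tangent spaces spanned by vectors of `R`, two functionals that
never take opposite signs on `R` have a common maximizer. -/
lemma IsUPolyhedron.exists_common_max {R P : Set V} (hP : IsUPolyhedron (flats R) P)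
    (hne : P.Nonempty) {q r : Module.Dual ℝ V} (hqr : ∀ α ∈ R, 0 ≤ q α * r α)
    (hbdd : BddAbove ((q + r) '' P)) :
    ∃ x ∈ P, (∀ y ∈ P, q y ≤ q x) ∧ ∀ y ∈ P, r y ≤ r x := by
  obtain ⟨x, hx, hmax⟩ := hP.1.exists_isMax hne hbdd
  have main : ∀ q r : Module.Dual ℝ V, (∀ α ∈ R, 0 ≤ q α * r α) →
      (∀ y ∈ P, (q + r) y ≤ (q + r) x) → ∀ y ∈ P, q y ≤ q x := by
    classical
    clear hqr hbdd hmax q r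
    intro q r hqr hmax y₀ hy₀
    by_contra! hlt
    obtain ⟨⟨s, rfl⟩, hflat⟩ := hP
    change ∀ y ∈ solutionSet s, _ at hmax
    -- The cone of feasible directions at `x`, truncated by `r ≥ -1`. On it `q ≤ -r ≤ 1`, because `q
    -- + r` is maximal at `x`; hence `q` attains a maximum there.
    set C : Finset (Module.Dual ℝ V × ℝ) :=
      insert (-r, 1) ((tight s x).image fun c => (c.1, 0)) with hC
    have hmemC : ∀ d, d ∈ solutionSet C ↔ -r d ≤ 1 ∧ ∀ c ∈ tight s x, c.1 d ≤ 0 := by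
      intro d
      simp only [hC, solutionSet, Finset.forall_mem_insert, Finset.forall_mem_image,
        Set.mem_ofPred_eq, LinearMap.neg_apply]
    have hcone : ∀ d, (∀ c ∈ tight s x, c.1 d ≤ 0) → q d + r d ≤ 0 := by
      intro d hd
      obtain ⟨ε, hε, h⟩ := exists_small_step hx hd
      have := hmax _ h
      simp only [map_add, map_smul, smul_eq_mul, LinearMap.add_apply] at this
      nlinarith
    have hsub : ∀ y ∈ solutionSet s, ∀ c ∈ tight s x, c.1 (y - x) ≤ 0 := by
      intro y hy c hc
      have := hy c (mem_tight.1 hc).1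
      rw [map_sub, (mem_tight.1 hc).2]
      linarith
    obtain ⟨d, hd, hdmax⟩ := IsPolyhedron.exists_isMax (P := solutionSet C) ⟨C, rfl⟩
      ⟨0, by rw [hmemC]; simp⟩ (p := q) ⟨1, by
        rintro _ ⟨d, hd, rfl⟩
        rw [hmemC] at hd
        linarith [hcone d hd.2]⟩
    rw [hmemC] at hd
    have hscale : ∀ y ∈ solutionSet s, r (y - x) < 0 → q (y - x) ≤ q d * (-r (y - x)) := by
      intro y hy hr
      have hpos : 0 < (-r (y - x))⁻¹ := inv_pos.2 (by linarith)
      have := hdmax ((-r (y - x))⁻¹ • (y - x)) <| by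
        rw [hmemC]
        refine ⟨?_, fun c hc => ?_⟩
        · rw [map_smul, smul_eq_mul, ← mul_neg, inv_mul_cancel₀ (by linarith)]
        · rw [map_smul, smul_eq_mul]
          exact mul_nonpos_of_nonneg_of_nonpos hpos.le (hsub y hy c hc)
      rw [map_smul, smul_eq_mul, inv_mul_le_iff₀ (by linarith)] at this
      linarith
    have hqy : 0 < q (y₀ - x) := by rw [map_sub]; linarith
    have hry : r (y₀ - x) < 0 := by linarith [hcone _ (hsub y₀ hy₀)]
    have hpos : 0 < q d := by
      have := hscale y₀ hy₀ hry
      by_contra! h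
      nlinarith
    have hle : q d ≤ 1 := by linarith [hcone d hd.2]
    -- The weight `q d` is the best exchange rate of `q` against `r`, so `g` is still maximal at `x`
    -- while `d` becomes a direction in its face. A root tangent to that face satisfies `q α = -(q
    -- d) * r α`; sign compatibility forces both values to vanish, so `q d = 0`, a contradiction.
    set g : Module.Dual ℝ V := q + q d • r with hg
    have hgv : ∀ v, g v = q v + q d * r v := fun v => by simp [hg]
    have hgmax : ∀ y ∈ solutionSet s, g y ≤ g x := by
      intro y hy
      have : g (y - x) ≤ 0 := by
        rw [hgv]
        rcases lt_or_ge (r (y - x)) 0 with h | h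
        · linarith [hscale y hy h]
        · nlinarith [hcone _ (hsub y hy)]
      rw [map_sub] at this
      linarith
    obtain ⟨ε, hε, hstep⟩ := exists_small_step hx hd.2
    have hgd : 0 ≤ g d := by rw [hgv]; nlinarith [hd.1]
    set F : Set V := {x | x ∈ solutionSet s ∧ ∀ y ∈ solutionSet s, g y ≤ g x} with hF
    have hxF : x ∈ F := ⟨hx, hgmax⟩
    have hstepF : x + ε • d ∈ F := ⟨hstep, fun y hy => by
      have := hgmax y hy
      simp only [map_add, map_smul, smul_eq_mul]
      nlinarith⟩
    obtain ⟨B, hBR, hB⟩ := hflat F ⟨⟨x, hxF⟩, g, rfl⟩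
    have hker : tangentSpace F ≤ LinearMap.ker q := by
      rw [hB, Submodule.span_le]
      intro α hα
      have h0 : g α = 0 := map_eq_zero_of_mem_tangentSpace (F := F)
        (fun x hx y hy => le_antisymm (hy.2 x hx.1) (hx.2 y hy.1))
        (hB ▸ Submodule.subset_span hα)
      rw [hgv] at h0
      have h1 := hqr α (hBR hα)
      have h2 : q α = - (q d * r α) := by linarith
      have h3 : q d * (r α * r α) ≤ 0 := by rw [h2] at h1; linarith
      have h4 : r α * r α ≤ 0 := by
        by_contra! h
        nlinarith [mul_pos hpos h]
      have h5 : r α = 0 := mul_self_eq_zero.1 (le_antisymm h4 (mul_self_nonneg _))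
      simp [h2, h5]
    have hmem : ε • d ∈ tangentSpace F := Submodule.subset_span ⟨_, hstepF, x, hxF, by simp⟩
    have : q (ε • d) = 0 := hker hmem
    rw [map_smul, smul_eq_mul] at this
    exact (mul_pos hε hpos).ne' this
  refine ⟨x, hx, main q r hqr hmax, main r q (fun α hα => ?_) ?_⟩
  · rw [mul_comm]; exact hqr α hα
  · simpa only [add_comm r q] using hmax

end Polyhedra

/-- A bounded polyhedron is a polytope. -/
lemma IsPolyhedron.isPolytope {N : Type*} [Fintype N] {P : Set (N → ℝ)} (hP : IsPolyhedron P)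
    (hb : Bornology.IsBounded P) : IsPolytope P := by
  obtain ⟨s, rfl⟩ := hP
  change Bornology.IsBounded (solutionSet s) at hb
  change IsPolytope (solutionSet s)
  have hinter : solutionSet s = ⋂ c ∈ s, {v | c.1 v ≤ c.2} := by
    ext
    simp [solutionSet]
  have hclosed : IsClosed (solutionSet s) := by
    rw [hinter]
    exact isClosed_biInter fun c _ =>
      isClosed_le (LinearMap.continuous_of_finiteDimensional c.1) continuous_const
  have hconv : Convex ℝ (solutionSet s) := by
    rw [hinter]
    exact convex_iInter₂ fun c _ => convex_halfSpace_le c.1.isLinear _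
  -- Two extreme points with the same tight constraints differ by a vector along which one can move
  -- both ways.
  have hinj : Set.InjOn (tight s) ((solutionSet s).extremePoints ℝ) := by
    intro x hx y hy h
    by_contra hne
    have hv : ∀ c ∈ tight s x, c.1 (x - y) = 0 := fun c hc => by
      rw [map_sub, (mem_tight.1 hc).2, (mem_tight.1 (h ▸ hc)).2, sub_self]
    obtain ⟨ε, hε, h1⟩ := exists_small_step hx.1 fun c hc => (hv c hc).le
    obtain ⟨δ, hδ, h2⟩ := exists_small_step (v := -(x - y)) hx.1 fun c hc => by
      rw [map_neg, hv c hc, neg_zero]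
    have hseg : x ∈ openSegment ℝ (x + ε • (x - y)) (x + δ • -(x - y)) := by
      refine ⟨δ / (ε + δ), ε / (ε + δ), by positivity, by positivity, by field_simp; ring, ?_⟩
      ext i
      simp only [Pi.add_apply, Pi.smul_apply, smul_eq_mul, Pi.sub_apply, Pi.neg_apply]
      field_simp
      ring
    have := hx.2 h1 h2 hseg
    have h0 : ε • (x - y) = 0 := by simpa using this
    rcases smul_eq_zero.1 h0 with h | h
    · exact hε.ne' h
    · exact hne (sub_eq_zero.1 h)
  have hfin : ((solutionSet s).extremePoints ℝ).Finite := by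
    refine Set.Finite.of_finite_image (f := tight s) ?_ hinj
    refine (s.powerset.finite_toSet).subset ?_
    rintro _ ⟨x, -, rfl⟩
    exact Finset.mem_coe.2 <| Finset.mem_powerset.2 fun d hd => (mem_tight.1 hd).1
  refine ⟨hfin.toFinset, ?_⟩
  rw [hfin.coe_toFinset, ← hfin.isClosed_convexHull ℝ |>.closure_eq]
  exact (closure_convexHull_extremePoints (Metric.isCompact_of_isClosed_isBounded hclosed hb)
    hconv).symm

lemma IsPolytope.isBounded {N : Type*} [Fintype N] {P : Set (N → ℝ)} (hP : IsPolytope P) :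
    Bornology.IsBounded P := by
  obtain ⟨s, rfl⟩ := hP
  exact isBounded_convexHull.2 s.finite_toSet.isBounded

/-! ### The greedy algorithm and submodular functions on rings of sets -/

section Greedy

variable {V : Type*} [Fintype V] [DecidableEq V]

/-- The greedy algorithm for a real-valued submodular function `h`: there is a base of `h`
maximizing `p`, its coordinates are differences of values of `h`, and it is tight on the upper level
sets of `p`. -/
lemma exists_greedy {h : Finset V → ℝ} (h0 : h ∅ = 0)
    (hsub : ∀ S T, h (S ∪ T) + h (S ∩ T) ≤ h S + h T) (p : V → ℝ) :
    ∃ x : V → ℝ, (∀ S, meas x S ≤ h S) ∧ meas x Finset.univ = h Finset.univ ∧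
      (∀ S, (∀ i ∈ S, ∀ j ∉ S, p j < p i) → meas x S = h S) ∧
      (∀ y : V → ℝ, (∀ S, meas y S ≤ h S) → meas y Finset.univ = h Finset.univ →
        ∑ i, p i * y i ≤ ∑ i, p i * x i) ∧
      ∀ i, ∃ S T, x i = h S - h T := by
  set n := Fintype.card V with hn
  obtain ⟨e, he⟩ : ∃ e : Fin n ≃ V, Antitone (p ∘ e) := by
    let e₀ := (Fintype.equivFin V).symm
    refine ⟨(Tuple.sort fun i => -p (e₀ i)).trans e₀, fun i j hij => ?_⟩
    have := Tuple.monotone_sort (fun i => -p (e₀ i)) hij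
    simpa using this
  let r : V → ℕ := fun i => e.symm i
  have hrn : ∀ i, r i < n := fun i => (e.symm i).2
  have hrinj : ∀ i j, r i = r j → i = j := fun i j hij => e.symm.injective (Fin.ext hij)
  have hrp : ∀ i j, r i ≤ r j → p j ≤ p i := fun i j hij => by
    have := he (a := e.symm i) (b := e.symm j) hij
    simpa using this
  let pre : ℕ → Finset V := fun k => Finset.univ.filter fun i => r i < k
  have hpre : ∀ i k, i ∈ pre k ↔ r i < k := fun i k => by simp [pre]
  have hpre0 : pre 0 = ∅ := by ext i; simp [hpre]
  have hpren : pre n = Finset.univ := by ext i; simp [hpre, hrn]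
  have hsucc : ∀ k < n, ∃ i, r i = k ∧ i ∉ pre k ∧ pre (k + 1) = insert i (pre k) := by
    intro k hk
    have hi : r (e ⟨k, hk⟩) = k := by simp [r]
    refine ⟨e ⟨k, hk⟩, hi, by simp [hpre, hi], ?_⟩
    ext j
    rw [Finset.mem_insert, hpre, hpre, Nat.lt_succ_iff_lt_or_eq, or_comm]
    refine or_congr ⟨fun hj => hrinj _ _ (hj.trans hi.symm), fun hj => hj ▸ hi⟩ Iff.rfl
  -- Marginal values of `h` along the chain of prefixes, in order of decreasing `p`.
  let x : V → ℝ := fun i => h (pre (r i + 1)) - h (pre (r i))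
  have hle : ∀ S, ∀ k ≤ n, meas x (S ∩ pre k) ≤ h (S ∩ pre k) := by
    intro S k
    induction k with
    | zero => intro _; simp [hpre0, meas, h0]
    | succ k ih =>
      intro hk
      obtain ⟨i, hi, hik, hins⟩ := hsucc k hk
      have ih := ih (by omega)
      by_cases hiS : i ∈ S
      · have h1 : S ∩ pre (k + 1) = insert i (S ∩ pre k) := by
          rw [hins, Finset.inter_insert_of_mem hiS]
        have h2 : meas x (S ∩ pre (k + 1)) = x i + meas x (S ∩ pre k) := by
          rw [h1, meas, Finset.sum_insert (by simp [hik]), meas]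
        have h3 := hsub (S ∩ pre (k + 1)) (pre k)
        have h4 : S ∩ pre (k + 1) ∪ pre k = pre (k + 1) := by
          rw [h1, Finset.insert_union, Finset.union_eq_right.2 Finset.inter_subset_right, hins]
        have h5 : S ∩ pre (k + 1) ∩ pre k = S ∩ pre k := by
          rw [Finset.inter_assoc, hins, Finset.insert_inter_of_notMem hik, Finset.inter_self]
        rw [h4, h5] at h3
        have h6 : x i = h (pre (k + 1)) - h (pre k) := by simp only [x, hi]
        linarith
      · have h1 : S ∩ pre (k + 1) = S ∩ pre k := by
          rw [hins, Finset.inter_insert_of_notMem hiS]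
        rw [h1]
        exact ih
  have heq : ∀ k ≤ n, meas x (pre k) = h (pre k) := by
    intro k
    induction k with
    | zero => intro _; simp [hpre0, meas, h0]
    | succ k ih =>
      intro hk
      obtain ⟨i, hi, hik, hins⟩ := hsucc k hk
      have ih := ih (by omega)
      have h2 : meas x (pre (k + 1)) = x i + meas x (pre k) := by
        rw [hins, meas, Finset.sum_insert hik, meas]
      have h6 : x i = h (pre (k + 1)) - h (pre k) := by simp only [x, hi]
      linarith
  have huniv : meas x Finset.univ = h Finset.univ := by rw [← hpren]; exact heq n le_rfl
  refine ⟨x, fun S => ?_, huniv, fun S hS => ?_, fun y hy hyu => ?_, fun i => ⟨_, _, rfl⟩⟩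
  · simpa [hpren] using hle S n le_rfl
  -- An upper level set of `p` is a prefix, and `x` is tight on prefixes.
  · have : S = pre (S.sup fun i => r i + 1) := by
      ext j
      rw [hpre, Finset.lt_sup_iff]
      refine ⟨fun hj => ⟨j, hj, Nat.lt_succ_self _⟩, ?_⟩
      rintro ⟨i, hi, hji⟩
      by_contra hj
      exact (hS i hi j hj).not_ge (hrp j i (Nat.lt_succ_iff.1 hji))
    rw [this]
    exact heq _ (Finset.sup_le fun i _ => hrn i)
  · have hD : ∀ k ≤ n, 0 ≤ ∑ i ∈ pre k, (x i - y i) := by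
      intro k hk
      have h1 := heq k hk
      have h2 := hy (pre k)
      rw [meas] at h1 h2
      rw [Finset.sum_sub_distrib]
      linarith
    -- Abel summation in inductive form: the prefix sums of `x - y` are nonnegative and `p`
    -- decreases along the order.
    have hA : ∀ k ≤ n, ∀ c, (∀ i ∈ pre k, c ≤ p i) →
        c * ∑ i ∈ pre k, (x i - y i) ≤ ∑ i ∈ pre k, p i * (x i - y i) := by
      intro k
      induction k with
      | zero => simp [hpre0]
      | succ k ih =>
        intro hk c hc
        have hDk := hD (k + 1) hk
        obtain ⟨i, hi, hik, hins⟩ := hsucc k hk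
        have h1 := ih (by omega) (p i) fun j hj => hrp _ _ (by
          rw [hpre] at hj
          omega)
        have h2 := hc i (by rw [hins]; simp)
        rw [hins, Finset.sum_insert hik] at hDk
        rw [hins, Finset.sum_insert hik, Finset.sum_insert hik]
        nlinarith
    obtain ⟨c, hc⟩ := (Set.finite_range p).bddBelow
    have h1 := hA n le_rfl c fun i _ => hc ⟨i, rfl⟩
    have h2 : ∑ i ∈ pre n, (x i - y i) = 0 := by
      rw [meas] at huniv hyu
      rw [hpren, Finset.sum_sub_distrib, huniv, hyu, sub_self]
    rw [h2, hpren, mul_zero] at h1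
    simp only [mul_sub, Finset.sum_sub_distrib] at h1
    linarith

/-- A family of sets containing `∅` and the whole set and closed under union and intersection,
with a function submodular on it that vanishes at `∅` and at the whole set. -/
structure IsSubmodularOn (D : Set (Finset V)) (g : Finset V → ℝ) : Prop where
  empty_mem : ∅ ∈ D
  univ_mem : Finset.univ ∈ D
  empty : g ∅ = 0
  univ : g Finset.univ = 0
  union_mem : ∀ S ∈ D, ∀ T ∈ D, S ∪ T ∈ D
  inter_mem : ∀ S ∈ D, ∀ T ∈ D, S ∩ T ∈ D
  submodular : ∀ S ∈ D, ∀ T ∈ D, g (S ∪ T) + g (S ∩ T) ≤ g S + g T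

/-- A submodular function on a ring of sets extends to a submodular function on all sets that is
large off the ring. -/
lemma IsSubmodularOn.exists_extension {D : Set (Finset V)} {g : Finset V → ℝ}
    (hg : IsSubmodularOn D g) (C : ℝ) :
    ∃ h : Finset V → ℝ, (∀ S T, h (S ∪ T) + h (S ∩ T) ≤ h S + h T) ∧ (∀ S ∈ D, h S = g S) ∧
      (∀ S ∉ D, C ≤ h S) ∧
      ((∀ S ∈ D, ∃ z : ℤ, g S = z) → ∀ S, ∃ z : ℤ, h S = z) := by
  classical
  obtain ⟨K, hK⟩ : ∃ K, ∀ S, |g S| ≤ K := by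
    obtain ⟨K, hK⟩ := (Set.finite_range fun S => |g S|).bddAbove
    exact ⟨K, fun S => hK ⟨S, rfl⟩⟩
  -- The bound `2 * K` makes the extension agree with `g` on `D`, and `C + K` makes it at least `C`
  -- elsewhere. A natural number keeps integer values integer.
  obtain ⟨M, hM⟩ := exists_nat_ge (max (2 * K) (C + K))
  have hM1 : 2 * K ≤ M := (le_max_left _ _).trans hM
  have hM2 : C + K ≤ M := (le_max_right _ _).trans hM
  let A : Finset V → Finset (Finset V) := fun S => S.powerset.filter (· ∈ D)
  have hA : ∀ S T, T ∈ A S ↔ T ⊆ S ∧ T ∈ D := fun S T => by simp [A]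
  have hne : ∀ S, (A S).Nonempty := fun S => ⟨∅, by simp [hA, hg.empty_mem]⟩
  -- Approximate `S` from inside by a member of `D`, paying `M` for each omitted element. The
  -- penalty is modular, so the minimum inherits submodularity.
  let w : Finset V → Finset V → ℝ := fun S T => g T + M * ((S.card : ℝ) - T.card)
  let h : Finset V → ℝ := fun S => (A S).inf' (hne S) (w S)
  have hle : ∀ S T, T ⊆ S → T ∈ D → h S ≤ w S T := fun S T h1 h2 =>
    Finset.inf'_le _ ((hA S T).2 ⟨h1, h2⟩)
  have hex : ∀ S, ∃ T, T ⊆ S ∧ T ∈ D ∧ h S = w S T := fun S => by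
    obtain ⟨T, hT, hT'⟩ := Finset.exists_mem_eq_inf' (hne S) (w S)
    rw [hA] at hT
    exact ⟨T, hT.1, hT.2, hT'⟩
  have hlarge : ∀ S T, T ⊆ S → T ≠ S → (M : ℝ) - K ≤ w S T := by
    intro S T hTS hne
    have h1 : (T.card : ℝ) + 1 ≤ S.card := by
      exact_mod_cast Finset.card_lt_card (lt_of_le_of_ne hTS hne)
    have h2 := neg_abs_le (g T)
    have h3 := hK T
    have h4 : (0 : ℝ) ≤ M := Nat.cast_nonneg _
    simp only [w]
    nlinarith
  refine ⟨h, fun S T => ?_, fun S hS => ?_, fun S hS => ?_, fun hint S => ?_⟩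
  · obtain ⟨S', hS1, hS2, hS3⟩ := hex S
    obtain ⟨T', hT1, hT2, hT3⟩ := hex T
    have h1 := hle (S ∪ T) (S' ∪ T') (Finset.union_subset_union hS1 hT1)
      (hg.union_mem _ hS2 _ hT2)
    have h2 := hle (S ∩ T) (S' ∩ T') (Finset.inter_subset_inter hS1 hT1)
      (hg.inter_mem _ hS2 _ hT2)
    have h3 := hg.submodular _ hS2 _ hT2
    have h4 : ((S ∪ T).card : ℝ) + (S ∩ T).card = S.card + T.card := by
      exact_mod_cast Finset.card_union_add_card_inter S T
    have h5 : ((S' ∪ T').card : ℝ) + (S' ∩ T').card = S'.card + T'.card := by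
      exact_mod_cast Finset.card_union_add_card_inter S' T'
    rw [hS3, hT3]
    simp only [w] at h1 h2 ⊢
    linear_combination h1 + h2 + h3 + M * h4 - M * h5
  · refine le_antisymm (by simpa [w] using hle S S subset_rfl hS) ?_
    obtain ⟨T, hT1, hT2, hT3⟩ := hex S
    rw [hT3]
    by_cases hTS : T = S
    · simp [w, hTS]
    · have := hlarge S T hT1 hTS
      linarith [le_abs_self (g S), hK S]
  · obtain ⟨T, hT1, hT2, hT3⟩ := hex S
    rw [hT3]
    have := hlarge S T hT1 (fun h => hS (h ▸ hT2))
    linarith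
  · obtain ⟨T, hT1, hT2, hT3⟩ := hex S
    obtain ⟨z, hz⟩ := hint T hT2
    exact ⟨z + M * ((S.card : ℤ) - T.card), by rw [hT3]; simp [w, hz]⟩

/-- A vector with zero sum over all members of a ring of sets is a combination of vectors
`e_i - e_j` where `i`, `j` are not separated by the ring. -/
lemma mem_span_of_forall_meas_eq_zero {D : Set (Finset V)} (hempty : ∅ ∈ D)
    (huniv : Finset.univ ∈ D) (hunion : ∀ S ∈ D, ∀ T ∈ D, S ∪ T ∈ D)
    (hinter : ∀ S ∈ D, ∀ T ∈ D, S ∩ T ∈ D) {v : V → ℝ} (hv : ∀ S ∈ D, meas v S = 0) :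
    v ∈ Submodule.span ℝ {u : V → ℝ | ∃ i j, (∀ S ∈ D, i ∈ S ↔ j ∈ S) ∧
      u = Pi.single i 1 - Pi.single j 1} := by
  classical
  let st : Setoid V := ⟨fun i j => ∀ S ∈ D, i ∈ S ↔ j ∈ S,
    ⟨fun _ _ _ => Iff.rfl, fun h S hS => (h S hS).symm, fun h h' S hS => (h S hS).trans (h' S hS)⟩⟩
  have hclass : ∀ i, ∑ j with st j i, v j = 0 := by
    intro i
    -- The least member containing `i` and the greatest member avoiding `i`; the class of `i` is
    -- their difference `X \ Y`.
    let X := (Finset.univ.filter fun S => S ∈ D ∧ i ∈ S).inf id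
    let Y := (Finset.univ.filter fun S => S ∈ D ∧ i ∉ S).sup id
    have hX : X ∈ D := Finset.inf_induction (p := (· ∈ D)) huniv (fun S hS T hT => hinter S hS T hT)
      fun S hS => (Finset.mem_filter.1 hS).2.1
    have hY : Y ∈ D := Finset.sup_induction (p := (· ∈ D)) hempty (fun S hS T hT => hunion S hS T hT)
      fun S hS => (Finset.mem_filter.1 hS).2.1
    have hXm : ∀ j, j ∈ X ↔ ∀ S ∈ D, i ∈ S → j ∈ S := by
      intro j
      simp [X, Finset.mem_inf]
    have hYm : ∀ j, j ∈ Y ↔ ∃ S ∈ D, i ∉ S ∧ j ∈ S := by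
      intro j
      simp [Y, Finset.mem_sup, and_assoc]
    have heq : (Finset.univ.filter fun j => st j i) = X \ (X ∩ Y) := by
      ext j
      simp only [Finset.mem_filter, Finset.mem_univ, true_and, Finset.mem_sdiff, Finset.mem_inter,
        hXm, hYm]
      constructor
      · intro h
        refine ⟨fun S hS hi => (h S hS).2 hi, ?_⟩
        rintro ⟨-, S, hS, hi, hj⟩
        exact hi ((h S hS).1 hj)
      · rintro ⟨h1, h2⟩ S hS
        refine ⟨fun hj => ?_, h1 S hS⟩
        by_contra hi
        exact h2 ⟨h1, S, hS, hi, hj⟩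
    have h1 := Finset.sum_sdiff (f := v) (Finset.inter_subset_left (s₁ := X) (s₂ := Y))
    have h2 := hv X hX
    have h3 := hv _ (hinter X hX Y hY)
    rw [meas] at h2 h3
    rw [heq]
    linarith
  let ρ : V → V := fun i => (Quotient.mk st i).out
  have hρ : ∀ i, st (ρ i) i := fun i => Quotient.mk_out (s := st) i
  have hρeq : ∀ i j, ρ i = j → (∀ k, st k j ↔ ρ k = j) := by
    rintro i j rfl k
    constructor
    · intro h
      have : Quotient.mk st k = Quotient.mk st i := Quotient.sound (st.trans h (hρ i))
      simp only [ρ, this]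
    · intro h
      have := hρ k
      rw [h] at this
      exact st.symm this
  have hzero : ∑ i, v i • (Pi.single (ρ i) 1 : V → ℝ) = 0 := by
    ext j
    simp only [Finset.sum_apply, Pi.smul_apply, Pi.single_apply, smul_eq_mul, mul_ite, mul_one,
      mul_zero, Pi.zero_apply]
    rw [← Finset.sum_filter]
    by_cases hj : ∃ i, ρ i = j
    · obtain ⟨i, hi⟩ := hj
      rw [← hclass j]
      refine Finset.sum_congr (Finset.filter_congr fun k _ => ?_) fun _ _ => rfl
      rw [hρeq i j hi k, eq_comm]
    · push Not at hj
      refine Finset.sum_eq_zero fun i hi => absurd (Finset.mem_filter.1 hi).2.symm (hj i)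
  -- Moving all mass of `v` to class representatives leaves nothing, since each class has total
  -- zero.
  have hsum : v = ∑ i, v i • ((Pi.single i 1 : V → ℝ) - Pi.single (ρ i) 1) := by
    simp only [smul_sub, Finset.sum_sub_distrib, hzero, sub_zero]
    exact pi_eq_sum_univ' v
  rw [hsum]
  refine Submodule.sum_mem _ fun i _ => Submodule.smul_mem _ _ (Submodule.subset_span ?_)
  exact ⟨i, ρ i, fun S hS => (hρ i S hS).symm, rfl⟩

end Greedy

/-! ### Functionals in coordinates and support values -/

section Functionals

variable {N : Type*}

/-- The functional `x ↦ ∑ i, p i * x i`. -/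
def dotDual [Fintype N] (p : N → ℝ) : Module.Dual ℝ (N → ℝ) := ∑ i, p i • LinearMap.proj i

lemma dotDual_apply [Fintype N] (p x : N → ℝ) : dotDual p x = ∑ i, p i * x i := by
  simp [dotDual]

lemma dotDual_neg [Fintype N] (p x : N → ℝ) : dotDual (-p) x = -dotDual p x := by
  simp [dotDual_apply]

lemma eq_dotDual [Fintype N] [DecidableEq N] (p : Module.Dual ℝ (N → ℝ)) :
    p = dotDual fun i => p (Pi.single i 1) := by
  ext i
  simp [dotDual_apply, Pi.single_apply]

lemma dotDual_single [Fintype N] [DecidableEq N] (p : N → ℝ) (i : N) : dotDual p (Pi.single i 1) = p i := by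
  simp [dotDual_apply, Pi.single_apply]

/-- The indicator vector of `S`. -/
def indic [DecidableEq N] (S : Finset N) (i : N) : ℝ := if i ∈ S then 1 else 0

lemma dotDual_indic [Fintype N] [DecidableEq N] (S : Finset N) (x : N → ℝ) :
    dotDual (indic S) x = meas x S := by
  simp [dotDual_apply, indic, meas]

lemma meas_union_add_meas_inter [DecidableEq N] (x : N → ℝ) (S T : Finset N) :
    meas x (S ∪ T) + meas x (S ∩ T) = meas x S + meas x T :=
  Finset.sum_union_inter

lemma meas_sdiff_sub_meas_sdiff [DecidableEq N] (x : N → ℝ) (S T : Finset N) :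
    meas x (S \ T) - meas x (T \ S) = meas x S - meas x T := by
  have h1 := Finset.sum_inter_add_sum_sdiff S T x
  have h2 := Finset.sum_inter_add_sum_sdiff T S x
  rw [Finset.inter_comm] at h2
  simp only [meas]
  linarith

lemma nonneg_on_rootsA [Fintype N] [DecidableEq N] {q r : N → ℝ} (h1 : ∀ i, 0 ≤ q i * r i)
    (h2 : ∀ i j, 0 ≤ (q i - q j) * (r i - r j)) :
    ∀ α ∈ rootsA N, 0 ≤ dotDual q α * dotDual r α := by
  rintro α (⟨i, rfl⟩ | ⟨i, rfl⟩ | ⟨i, j, rfl⟩)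
  · simpa [dotDual_single] using h1 i
  · simpa [dotDual_single] using h1 i
  · simpa [dotDual_single] using h2 i j

lemma meas_le_upperFn {P : Set (N → ℝ)} {x : N → ℝ} (hx : x ∈ P) (S : Finset N) :
    (meas x S : EReal) ≤ upperFn P S :=
  le_iSup₂_of_le x hx le_rfl

lemma lowerFn_le_meas {P : Set (N → ℝ)} {x : N → ℝ} (hx : x ∈ P) (S : Finset N) :
    lowerFn P S ≤ (meas x S : EReal) :=
  iInf₂_le_of_le x hx le_rfl

lemma upperFn_eq {P : Set (N → ℝ)} {x : N → ℝ} (hx : x ∈ P) {S : Finset N}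
    (h : ∀ y ∈ P, meas y S ≤ meas x S) : upperFn P S = (meas x S : EReal) :=
  le_antisymm (iSup₂_le fun y hy => EReal.coe_le_coe_iff.2 (h y hy)) (meas_le_upperFn hx S)

lemma lowerFn_eq {P : Set (N → ℝ)} {x : N → ℝ} (hx : x ∈ P) {S : Finset N}
    (h : ∀ y ∈ P, meas x S ≤ meas y S) : lowerFn P S = (meas x S : EReal) :=
  le_antisymm (lowerFn_le_meas hx S) (le_iInf₂ fun y hy => EReal.coe_le_coe_iff.2 (h y hy))

lemma exists_meas_le_of_upperFn_ne_top {P : Set (N → ℝ)} (hne : P.Nonempty) {S : Finset N}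
    (h : upperFn P S ≠ ⊤) : ∃ C : ℝ, ∀ x ∈ P, meas x S ≤ C := by
  obtain ⟨x, hx⟩ := hne
  have hbot : upperFn P S ≠ ⊥ := fun h' => by
    simpa [h'] using meas_le_upperFn hx S
  lift upperFn P S to ℝ using ⟨h, hbot⟩ with C hC
  exact ⟨C, fun y hy => by
    have := meas_le_upperFn hy S
    rw [← hC] at this
    exact EReal.coe_le_coe_iff.1 this⟩

lemma exists_le_meas_of_lowerFn_ne_bot {P : Set (N → ℝ)} (hne : P.Nonempty) {S : Finset N}
    (h : lowerFn P S ≠ ⊥) : ∃ C : ℝ, ∀ x ∈ P, C ≤ meas x S := by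
  obtain ⟨x, hx⟩ := hne
  have htop : lowerFn P S ≠ ⊤ := fun h' => by
    simpa [h'] using lowerFn_le_meas hx S
  lift lowerFn P S to ℝ using ⟨htop, h⟩ with C hC
  exact ⟨C, fun y hy => by
    have := lowerFn_le_meas hy S
    rw [← hC] at this
    exact EReal.coe_le_coe_iff.1 this⟩

end Functionals

/-! ### From `𝔸_N`-polyhedra to strong pairs -/

section FromPolyhedra

variable {N : Type*} [Fintype N] [DecidableEq N] {P : Set (N → ℝ)}

/-- Two sign-compatible functionals with sum bounded above on an `𝔸_N`-polyhedron have a common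
maximizer. -/
lemma IsANPolyhedron.exists_common_max (hP : IsANPolyhedron P) (hne : P.Nonempty) {q r : N → ℝ}
    (h1 : ∀ i, 0 ≤ q i * r i) (h2 : ∀ i j, 0 ≤ (q i - q j) * (r i - r j)) {C : ℝ}
    (hC : ∀ x ∈ P, dotDual q x + dotDual r x ≤ C) :
    ∃ x ∈ P, (∀ y ∈ P, dotDual q y ≤ dotDual q x) ∧ ∀ y ∈ P, dotDual r y ≤ dotDual r x :=
  IsUPolyhedron.exists_common_max hP hne (nonneg_on_rootsA h1 h2)
    ⟨C, by rintro _ ⟨x, hx, rfl⟩; exact hC x hx⟩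

/-- When a value on the larger side of an inequality is infinite there is nothing to prove.
Otherwise one common maximizer realizes both values on the other side, and a modular identity for
measures concludes. -/
lemma IsANPolyhedron.isStrongPair (hP : IsANPolyhedron P) (hne : P.Nonempty) :
    IsStrongPair (upperFn P) (lowerFn P) := by
  obtain ⟨x₀, hx₀⟩ := hne
  have hb : ∀ S, upperFn P S ≠ ⊥ := fun S h => by simpa [h] using meas_le_upperFn hx₀ S
  have ha : ∀ S, lowerFn P S ≠ ⊤ := fun S h => by simpa [h] using lowerFn_le_meas hx₀ S
  refine ⟨hb, ha, ?_, ?_, fun S T => ?_, fun S T => ?_, fun S T => ?_⟩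
  · rw [upperFn_eq hx₀ (by simp [meas])]
    simp [meas]
  · rw [lowerFn_eq hx₀ (by simp [meas])]
    simp [meas]
  · by_cases hS : upperFn P S = ⊤
    · simp [hS, EReal.top_add_of_ne_bot (hb T)]
    by_cases hT : upperFn P T = ⊤
    · simp [hT, EReal.add_top_of_ne_bot (hb S)]
    obtain ⟨C, hC⟩ := exists_meas_le_of_upperFn_ne_top ⟨x₀, hx₀⟩ hS
    obtain ⟨C', hC'⟩ := exists_meas_le_of_upperFn_ne_top ⟨x₀, hx₀⟩ hT
    obtain ⟨x, hx, hx1, hx2⟩ := hP.exists_common_max ⟨x₀, hx₀⟩ (q := indic (S ∪ T))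
      (r := indic (S ∩ T)) (fun i => by simp only [indic]; split_ifs <;> simp) (fun i j => by
        simp only [indic, Finset.mem_union, Finset.mem_inter]
        by_cases h1 : i ∈ S <;> by_cases h2 : i ∈ T <;> by_cases h3 : j ∈ S <;>
          by_cases h4 : j ∈ T <;> simp [h1, h2, h3, h4]) (C := C + C') fun y hy => by
        rw [dotDual_indic, dotDual_indic, meas_union_add_meas_inter]
        exact add_le_add (hC y hy) (hC' y hy)
    simp only [dotDual_indic] at hx1 hx2
    rw [upperFn_eq hx hx1, upperFn_eq hx hx2, ← EReal.coe_add, meas_union_add_meas_inter,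
      EReal.coe_add]
    exact add_le_add (meas_le_upperFn hx S) (meas_le_upperFn hx T)
  · by_cases hS : lowerFn P S = ⊥
    · simp [hS]
    by_cases hT : lowerFn P T = ⊥
    · simp [hT]
    obtain ⟨C, hC⟩ := exists_le_meas_of_lowerFn_ne_bot ⟨x₀, hx₀⟩ hS
    obtain ⟨C', hC'⟩ := exists_le_meas_of_lowerFn_ne_bot ⟨x₀, hx₀⟩ hT
    obtain ⟨x, hx, hx1, hx2⟩ := hP.exists_common_max ⟨x₀, hx₀⟩ (q := -indic (S ∪ T))
      (r := -indic (S ∩ T)) (fun i => by simp only [indic, Pi.neg_apply]; split_ifs <;> simp)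
      (fun i j => by
        simp only [indic, Pi.neg_apply, Finset.mem_union, Finset.mem_inter]
        by_cases h1 : i ∈ S <;> by_cases h2 : i ∈ T <;> by_cases h3 : j ∈ S <;>
          by_cases h4 : j ∈ T <;> simp [h1, h2, h3, h4]) (C := -C - C') fun y hy => by
        have := meas_union_add_meas_inter y S T
        rw [dotDual_neg, dotDual_neg, dotDual_indic, dotDual_indic]
        linarith [hC y hy, hC' y hy]
    simp only [dotDual_neg, dotDual_indic, neg_le_neg_iff] at hx1 hx2
    rw [lowerFn_eq hx hx1, lowerFn_eq hx hx2, ← EReal.coe_add, meas_union_add_meas_inter,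
      EReal.coe_add]
    exact add_le_add (lowerFn_le_meas hx S) (lowerFn_le_meas hx T)
  · by_cases hS : upperFn P S = ⊤
    · have : upperFn P S - lowerFn P T = ⊤ := by
        rw [hS, sub_eq_add_neg]
        exact EReal.top_add_of_ne_bot (by simpa [EReal.neg_eq_bot_iff] using ha T)
      simp [this]
    by_cases hT : lowerFn P T = ⊥
    · have : upperFn P S - lowerFn P T = ⊤ := by
        rw [hT, sub_eq_add_neg, EReal.neg_bot]
        exact EReal.add_top_of_ne_bot (hb S)
      simp [this]
    obtain ⟨C, hC⟩ := exists_meas_le_of_upperFn_ne_top ⟨x₀, hx₀⟩ hS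
    obtain ⟨C', hC'⟩ := exists_le_meas_of_lowerFn_ne_bot ⟨x₀, hx₀⟩ hT
    obtain ⟨x, hx, hx1, hx2⟩ := hP.exists_common_max ⟨x₀, hx₀⟩ (q := indic (S \ T))
      (r := -indic (T \ S)) (fun i => by
        simp only [indic, Pi.neg_apply, Finset.mem_sdiff]
        by_cases h1 : i ∈ S <;> by_cases h2 : i ∈ T <;> simp [h1, h2])
      (fun i j => by
        simp only [indic, Pi.neg_apply, Finset.mem_sdiff]
        by_cases h1 : i ∈ S <;> by_cases h2 : i ∈ T <;> by_cases h3 : j ∈ S <;>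
          by_cases h4 : j ∈ T <;> simp [h1, h2, h3, h4]) (C := C - C') fun y hy => by
        have := meas_sdiff_sub_meas_sdiff y S T
        rw [dotDual_neg, dotDual_indic, dotDual_indic]
        linarith [hC y hy, hC' y hy]
    simp only [dotDual_neg, dotDual_indic, neg_le_neg_iff] at hx1 hx2
    rw [upperFn_eq hx hx1, lowerFn_eq hx hx2, ← EReal.coe_sub, meas_sdiff_sub_meas_sdiff,
      EReal.coe_sub]
    exact EReal.sub_le_sub (meas_le_upperFn hx S) (lowerFn_le_meas hx T)

/-- A point satisfying all the inequalities `± x(S) ≤ max` valid on an `𝔸_N`-polyhedron satisfies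
all valid linear inequalities: the functional is split into sign-compatible summands `± λ 1_S`. -/
lemma IsANPolyhedron.exists_dotDual_le (hP : IsANPolyhedron P) (hne : P.Nonempty) {z : N → ℝ}
    (hz : ∀ σ : ℝ, σ = 1 ∨ σ = -1 → ∀ S, ∀ x ∈ P, (∀ y ∈ P, σ * meas y S ≤ σ * meas x S) →
      σ * meas z S ≤ σ * meas x S) (n : ℕ) :
    ∀ p : N → ℝ, (Finset.univ.filter fun i => p i ≠ 0).card = n →
      (∃ C, ∀ x ∈ P, dotDual p x ≤ C) → ∃ x ∈ P, dotDual p z ≤ dotDual p x := by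
  induction n using Nat.strong_induction_on with
  | _ n ih =>
  rintro p hpn ⟨C, hC⟩
  by_cases hp : p = 0
  · obtain ⟨x, hx⟩ := hne
    exact ⟨x, hx, by simp [hp, dotDual_apply]⟩
  obtain ⟨i₀, hi₀⟩ := Function.ne_iff.1 hp
  obtain ⟨σ, hσ, hσi⟩ : ∃ σ : ℝ, (σ = 1 ∨ σ = -1) ∧ 0 < σ * p i₀ := by
    rcases lt_or_gt_of_ne hi₀ with h | h
    · exact ⟨-1, Or.inr rfl, by simpa using h⟩
    · exact ⟨1, Or.inl rfl, by simpa using h⟩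
  have hσσ : σ * σ = 1 := by rcases hσ with rfl | rfl <;> norm_num
  -- Peel off `σ * l` times the indicator of the coordinates where `p` has sign `σ`, with `l` the
  -- least absolute value there. The remainder is sign-compatible with it and loses the minimizing
  -- index `k` from its support.
  set S : Finset N := Finset.univ.filter fun i => 0 < σ * p i with hS
  have hmemS : ∀ i, i ∈ S ↔ 0 < σ * p i := fun i => by simp [hS]
  obtain ⟨k, hk, hmin⟩ := S.exists_min_image (fun i => σ * p i) ⟨i₀, (hmemS _).2 hσi⟩
  have hl := (hmemS k).1 hk
  set l := σ * p k with hl_def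
  set q : N → ℝ := (σ * l) • indic S with hq
  have hqS : ∀ i ∈ S, q i = σ * l := fun i hi => by simp [hq, indic, hi]
  have hqn : ∀ i ∉ S, q i = 0 := fun i hi => by simp [hq, indic, hi]
  have hqv : ∀ y, dotDual q y = l * (σ * meas y S) := fun y => by
    rw [← dotDual_indic, dotDual_apply, dotDual_apply, hq, Finset.mul_sum, Finset.mul_sum]
    refine Finset.sum_congr rfl fun i _ => ?_
    simp only [Pi.smul_apply, smul_eq_mul]
    ring
  have hsplit : ∀ y, dotDual q y + dotDual (p - q) y = dotDual p y := fun y => by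
    simp only [dotDual_apply, ← Finset.sum_add_distrib, Pi.sub_apply]
    exact Finset.sum_congr rfl fun i _ => by ring
  have hcross : ∀ i ∈ S, ∀ j ∉ S, 0 ≤ (q i - q j) * ((p - q) i - (p - q) j) := by
    intro i hi j hj
    rw [Pi.sub_apply, Pi.sub_apply, hqS i hi, hqn j hj]
    have h1 := hmin i hi
    have h2 : σ * p j ≤ 0 := not_lt.1 fun h => hj ((hmemS j).2 h)
    have : (σ * l - 0) * (p i - σ * l - (p j - 0)) = l * (σ * p i - (σ * σ) * l - σ * p j) := by
      ring
    rw [this, hσσ]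
    exact mul_nonneg hl.le (by linarith)
  obtain ⟨x, hx, hx1, hx2⟩ := hP.exists_common_max hne (q := q) (r := p - q) (fun i => by
      by_cases hi : i ∈ S
      · rw [Pi.sub_apply, hqS i hi]
        have : σ * l * (p i - σ * l) = l * (σ * p i - (σ * σ) * l) := by ring
        rw [this, hσσ]
        exact mul_nonneg hl.le (by linarith [hmin i hi])
      · rw [hqn i hi, zero_mul])
    (fun i j => by
      by_cases hi : i ∈ S <;> by_cases hj : j ∈ S
      · rw [hqS i hi, hqS j hj, sub_self, zero_mul]
      · exact hcross i hi j hj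
      · linarith [hcross j hj i hi]
      · rw [hqn i hi, hqn j hj, sub_self, zero_mul]) (C := C) fun y hy => by
      rw [hsplit]; exact hC y hy
  have hlt : (Finset.univ.filter fun i => (p - q) i ≠ 0).card < n := by
    rw [← hpn]
    refine Finset.card_lt_card (Finset.ssubset_iff_of_subset (fun i hi => ?_) |>.2 ⟨k, ?_, ?_⟩)
    · simp only [Finset.mem_filter, Finset.mem_univ, true_and] at hi ⊢
      intro h
      refine hi ?_
      rw [Pi.sub_apply, h, hqn i (by simp [hmemS, h]), sub_zero]
    · simp only [Finset.mem_filter, Finset.mem_univ, true_and]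
      rintro h
      simp [hl_def, h] at hl
    · have : p k - σ * (σ * p k) = 0 := by rw [← mul_assoc, hσσ]; ring
      simp [hqS k hk, hl_def, this]
  obtain ⟨x', hx', hle⟩ := ih _ hlt (p - q) rfl ⟨_, hx2⟩
  refine ⟨x, hx, ?_⟩
  have h1 := hz σ hσ S x hx fun y hy => by
    have := hx1 y hy
    rw [hqv, hqv] at this
    exact le_of_mul_le_mul_left this hl
  have h2 := mul_le_mul_of_nonneg_left h1 hl.le
  rw [← hqv, ← hqv] at h2
  rw [← hsplit z, ← hsplit x]
  linarith [hx2 x' hx']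

/-- Each inequality defining `P` has a bounded functional, so it follows from the bounds on the sets
`S` by the splitting argument. -/
lemma IsANPolyhedron.gpoly_eq (hP : IsANPolyhedron P) (hne : P.Nonempty) :
    gpoly (upperFn P) (lowerFn P) = P := by
  refine Set.Subset.antisymm (fun z hz => ?_) fun x hx S =>
    ⟨lowerFn_le_meas hx S, meas_le_upperFn hx S⟩
  have hz' : ∀ σ : ℝ, σ = 1 ∨ σ = -1 → ∀ S, ∀ x ∈ P,
      (∀ y ∈ P, σ * meas y S ≤ σ * meas x S) → σ * meas z S ≤ σ * meas x S := by
    rintro σ (rfl | rfl) S x hx h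
    · simp only [one_mul] at h ⊢
      have := (hz S).2
      rw [upperFn_eq hx h] at this
      exact EReal.coe_le_coe_iff.1 this
    · simp only [neg_mul, one_mul, neg_le_neg_iff] at h ⊢
      have := (hz S).1
      rw [lowerFn_eq hx h] at this
      exact EReal.coe_le_coe_iff.1 this
  obtain ⟨s, hs⟩ := hP.1
  rw [hs]
  intro c hc
  have hcP : ∀ x ∈ P, c.1 x ≤ c.2 := fun x hx => by rw [hs] at hx; exact hx c hc
  obtain ⟨x, hx, hle⟩ := hP.exists_dotDual_le hne hz' _ (fun i => c.1 (Pi.single i 1)) rfl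
    ⟨c.2, fun x hx => by rw [← eq_dotDual]; exact hcP x hx⟩
  rw [← eq_dotDual] at hle
  exact hle.trans (hcP x hx)

end FromPolyhedra

/-! ### From strong pairs to polyhedra, through one additional point -/

section StrongPairs

variable {N : Type*}

/-- The restriction to `N` of a vector on `Option N`. -/
def restrict : (Option N → ℝ) →ₗ[ℝ] (N → ℝ) := LinearMap.funLeft ℝ ℝ some

lemma restrict_apply (y : Option N → ℝ) (i : N) : restrict y i = y (some i) := rfl

lemma restrict_single_sub_single_mem [DecidableEq N] (i j : Option N) :
    restrict (Pi.single i 1 - Pi.single j 1) = 0 ∨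
      restrict (Pi.single i 1 - Pi.single j 1) ∈ rootsA N := by
  have hnone : restrict (Pi.single (none : Option N) (1 : ℝ)) = 0 := by
    ext k; simp [restrict_apply]
  have hsome : ∀ i : N, restrict (Pi.single (some i) (1 : ℝ)) = Pi.single i 1 := by
    intro i; ext k; simp [restrict_apply, Pi.single_apply]
  rw [map_sub]
  rcases i with _ | i <;> rcases j with _ | j
  · left; simp
  · right; right; left; exact ⟨j, by simp [hnone, hsome]⟩
  · right; left; exact ⟨i, by simp [hnone, hsome]⟩
  · right; right; right; exact ⟨i, j, by simp [hsome]⟩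

lemma IsIntegerPolyhedron.exists_int_of_bddAbove [Fintype N] {P : Set (N → ℝ)} (hP : IsIntegerPolyhedron P)
    (hpoly : IsPolyhedron P) (hne : P.Nonempty) {p : Module.Dual ℝ (N → ℝ)}
    (hp : BddAbove (p '' P)) : ∃ z : N → ℤ, (fun i => (z i : ℝ)) ∈ P ∧
      ∀ y ∈ P, p y ≤ p fun i => (z i : ℝ) := by
  obtain ⟨x, hx, hmax⟩ := hpoly.exists_isMax hne hp
  exact hP.2 {x | x ∈ P ∧ ∀ y ∈ P, p y ≤ p x} ⟨⟨x, hx, hmax⟩, p, rfl⟩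

variable [Fintype N]

/-- The extension of `x` to one further point by the value that makes the total sum zero. -/
def extend : (N → ℝ) →ₗ[ℝ] (Option N → ℝ) where
  toFun x o := o.elim (-∑ i, x i) x
  map_add' x y := by
    ext (_ | i)
    · simp [Finset.sum_add_distrib, add_comm]
    · simp
  map_smul' c x := by
    ext (_ | i)
    · simp [Finset.mul_sum]
    · simp

lemma restrict_extend (x : N → ℝ) : restrict (extend x) = x := rfl

lemma extend_restrict {y : Option N → ℝ} (hy : meas y Finset.univ = 0) :
    extend (restrict y) = y := by
  ext (_ | i)
  · rw [meas, Fintype.sum_option] at hy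
    change -∑ i, y (some i) = y none
    linarith
  · rfl

lemma meas_extend_univ (x : N → ℝ) : meas (extend x) Finset.univ = 0 := by
  rw [meas, Fintype.sum_option]
  exact neg_add_cancel _

variable [DecidableEq N]

lemma meas_extend_of_notMem (x : N → ℝ) {S : Finset (Option N)} (h : none ∉ S) :
    meas (extend x) S = meas x (Finset.eraseNone S) := by
  have : S = (Finset.eraseNone S).map Function.Embedding.some := by
    rw [Finset.map_some_eraseNone, Finset.erase_eq_of_notMem h]
  conv_lhs => rw [this, meas, Finset.sum_map]
  rfl

lemma meas_extend_of_mem (x : N → ℝ) {S : Finset (Option N)} (h : none ∈ S) :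
    meas (extend x) S = -meas x (Finset.eraseNone S)ᶜ := by
  have h1 : meas (extend x) S + meas (extend x) Sᶜ = 0 := by
    rw [← meas_extend_univ x]
    exact Finset.sum_add_sum_compl S _
  have h2 : Finset.eraseNone Sᶜ = (Finset.eraseNone S)ᶜ := by
    ext i
    simp
  rw [meas_extend_of_notMem x (S := Sᶜ) (by simpa using h), h2] at h1
  linarith

/-- The functional `x ↦ x(S)` on the vectors extended to `Option N`. -/
def extDual (S : Finset (Option N)) : Module.Dual ℝ (N → ℝ) := dotDual (indic S) ∘ₗ extend

lemma extDual_apply (S : Finset (Option N)) (x : N → ℝ) : extDual S x = meas (extend x) S :=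
  dotDual_indic S _

lemma extDual_restrict (S : Finset (Option N)) {y : Option N → ℝ} (hy : meas y Finset.univ = 0) :
    extDual S (restrict y) = meas y S := by
  rw [extDual_apply, extend_restrict hy]

/-- The set function on `Option N` that encodes the pair `(b, a)`. -/
noncomputable def pairFn (b a : Finset N → EReal) (S : Finset (Option N)) : EReal :=
  if none ∈ S then -a (Finset.eraseNone S)ᶜ else b (Finset.eraseNone S)

/-- The sets on which `pairFn` is finite. -/
def finiteSets (b a : Finset N → EReal) : Set (Finset (Option N)) := {S | pairFn b a S ≠ ⊤}

variable {b a : Finset N → EReal}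

lemma pairFn_map_some (b a : Finset N → EReal) (S : Finset N) :
    pairFn b a (S.map Function.Embedding.some) = b S := by
  simp [pairFn]

lemma pairFn_insertNone_compl (b a : Finset N → EReal) (S : Finset N) :
    pairFn b a (Finset.insertNone Sᶜ) = -a S := by
  simp [pairFn]

lemma meas_extend_map_some (x : N → ℝ) (S : Finset N) :
    meas (extend x) (S.map Function.Embedding.some) = meas x S := by
  rw [meas_extend_of_notMem x (by simp), Finset.eraseNone_map_some]

lemma meas_extend_insertNone_compl (x : N → ℝ) (S : Finset N) :
    meas (extend x) (Finset.insertNone Sᶜ) = -meas x S := by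
  rw [meas_extend_of_mem x (by simp), Finset.eraseNone_insertNone, compl_compl]

lemma IsStrongPair.pairFn_ne_bot (h : IsStrongPair b a) (S : Finset (Option N)) :
    pairFn b a S ≠ ⊥ := by
  rw [pairFn]
  split_ifs
  · simpa [EReal.neg_eq_bot_iff] using h.a_ne_top _
  · exact h.b_ne_bot _

/-- Sets without `none` use submodularity of `b`, sets with `none` use supermodularity of `a` on
complements, and the mixed case is the cross inequality. -/
lemma IsStrongPair.pairFn_submodular (h : IsStrongPair b a) (S T : Finset (Option N)) :
    pairFn b a (S ∪ T) + pairFn b a (S ∩ T) ≤ pairFn b a S + pairFn b a T := by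
  have hmixed : ∀ S T : Finset (Option N), none ∉ S → none ∈ T →
      pairFn b a (S ∪ T) + pairFn b a (S ∩ T) ≤ pairFn b a S + pairFn b a T := by
    intro S T hS hT
    have := h.cross (Finset.eraseNone S) (Finset.eraseNone T)ᶜ
    simp only [pairFn, Finset.mem_union, Finset.mem_inter, hS, hT, or_true, and_true, if_true,
      if_false, Finset.eraseNone_union, Finset.eraseNone_inter]
    rw [sub_eq_add_neg, sub_eq_add_neg] at this
    refine le_trans (le_of_eq ?_) this
    rw [add_comm]
    congr 2
    · ext i; simp
    · congr 1; ext i; simp; tauto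
  by_cases hS : none ∈ S <;> by_cases hT : none ∈ T
  · have := h.supermodular (Finset.eraseNone S)ᶜ (Finset.eraseNone T)ᶜ
    rw [← EReal.neg_le_neg_iff, EReal.neg_add (Or.inr (h.a_ne_top _)) (Or.inl (h.a_ne_top _)),
      EReal.neg_add (Or.inr (h.a_ne_top _)) (Or.inl (h.a_ne_top _)), sub_eq_add_neg,
      sub_eq_add_neg, ← Finset.compl_inter, ← Finset.compl_union] at this
    simp only [pairFn, Finset.mem_union, Finset.mem_inter, hS, hT, or_true, and_true, if_true,
      Finset.eraseNone_union, Finset.eraseNone_inter]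
    rw [add_comm]
    exact this
  · rw [Finset.union_comm, Finset.inter_comm, add_comm (pairFn b a S)]
    exact hmixed T S hT hS
  · exact hmixed S T hS hT
  · simpa [pairFn, hS, hT, Finset.eraseNone_union, Finset.eraseNone_inter] using
      h.submodular (Finset.eraseNone S) (Finset.eraseNone T)

lemma IsStrongPair.coe_toReal (h : IsStrongPair b a) {S : Finset (Option N)}
    (hS : S ∈ finiteSets b a) : ((pairFn b a S).toReal : EReal) = pairFn b a S :=
  EReal.coe_toReal hS (h.pairFn_ne_bot S)

lemma IsStrongPair.isSubmodularOn (h : IsStrongPair b a) :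
    IsSubmodularOn (finiteSets b a) fun S => (pairFn b a S).toReal := by
  have h0 : pairFn b a ∅ = 0 := by simp [pairFn, h.b_empty]
  have hu : pairFn b a Finset.univ = 0 := by
    have : Finset.eraseNone (Finset.univ : Finset (Option N)) = Finset.univ := by ext; simp
    simp [pairFn, this, h.a_empty]
  have hfin : ∀ S ∈ finiteSets b a, ∀ T ∈ finiteSets b a,
      pairFn b a (S ∪ T) ≠ ⊤ ∧ pairFn b a (S ∩ T) ≠ ⊤ := by
    intro S hS T hT
    have h1 := h.pairFn_submodular S T
    rw [← h.coe_toReal hS, ← h.coe_toReal hT, ← EReal.coe_add] at h1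
    refine ⟨fun h' => ?_, fun h' => ?_⟩
    · rw [h', EReal.top_add_of_ne_bot (h.pairFn_ne_bot _), top_le_iff] at h1
      exact EReal.coe_ne_top _ h1
    · rw [h', EReal.add_top_of_ne_bot (h.pairFn_ne_bot _), top_le_iff] at h1
      exact EReal.coe_ne_top _ h1
  refine ⟨by simp [finiteSets, h0], by simp [finiteSets, hu], by simp [h0], by simp [hu],
    fun S hS T hT => (hfin S hS T hT).1, fun S hS T hT => (hfin S hS T hT).2,
    fun S hS T hT => ?_⟩
  rw [← EReal.coe_le_coe_iff, EReal.coe_add, EReal.coe_add, h.coe_toReal hS, h.coe_toReal hT,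
    h.coe_toReal (hfin S hS T hT).1, h.coe_toReal (hfin S hS T hT).2]
  exact h.pairFn_submodular S T

lemma mem_gpoly_iff_pairFn {x : N → ℝ} :
    x ∈ gpoly b a ↔ ∀ S, (meas (extend x) S : EReal) ≤ pairFn b a S := by
  constructor
  · intro hx S
    by_cases hS : none ∈ S
    · rw [meas_extend_of_mem x hS, pairFn, if_pos hS, EReal.coe_neg, EReal.neg_le_neg_iff]
      exact (hx _).1
    · rw [meas_extend_of_notMem x hS, pairFn, if_neg hS]
      exact (hx _).2
  · intro hx S
    have h1 := hx (S.map Function.Embedding.some)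
    have h2 := hx (Finset.insertNone Sᶜ)
    rw [pairFn_map_some, meas_extend_map_some] at h1
    rw [pairFn_insertNone_compl, meas_extend_insertNone_compl, EReal.coe_neg,
      EReal.neg_le_neg_iff] at h2
    exact ⟨h2, h1⟩

lemma IsStrongPair.mem_gpoly_iff (h : IsStrongPair b a) {x : N → ℝ} :
    x ∈ gpoly b a ↔ ∀ S ∈ finiteSets b a, meas (extend x) S ≤ (pairFn b a S).toReal := by
  rw [mem_gpoly_iff_pairFn]
  refine forall_congr' fun S => ?_
  by_cases hS : S ∈ finiteSets b a
  · rw [← h.coe_toReal hS, EReal.coe_le_coe_iff]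
    simp [hS]
  · have : pairFn b a S = ⊤ := by simpa [finiteSets] using hS
    simp [hS, this]

/-- The system of inequalities that defines the generalized polymatroid of a strong pair. -/
noncomputable def gpolySystem (b a : Finset N → EReal) : Finset (Module.Dual ℝ (N → ℝ) × ℝ) :=
  open Classical in
    (Finset.univ.filter (· ∈ finiteSets b a)).image fun S => (extDual S, (pairFn b a S).toReal)

lemma IsStrongPair.gpoly_eq_solutionSet (h : IsStrongPair b a) :
    gpoly b a = solutionSet (gpolySystem b a) := by
  ext x
  simp only [h.mem_gpoly_iff, solutionSet, gpolySystem, Finset.forall_mem_image,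
    Finset.mem_filter, Finset.mem_univ, true_and, Set.mem_ofPred_eq, extDual_apply]

lemma IsStrongPair.isPolyhedron_gpoly (h : IsStrongPair b a) : IsPolyhedron (gpoly b a) :=
  ⟨_, h.gpoly_eq_solutionSet⟩

/-- Bases of a finite extension of `pairFn` have total zero, hence are recovered from their
restriction to `N`. -/
lemma IsStrongPair.restrict_mem_gpoly (h : IsStrongPair b a) {f : Finset (Option N) → ℝ}
    (hf : ∀ S ∈ finiteSets b a, f S = (pairFn b a S).toReal) {y : Option N → ℝ}
    (hy : ∀ S, meas y S ≤ f S) (hyu : meas y Finset.univ = f Finset.univ) :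
    restrict y ∈ gpoly b a ∧ extend (restrict y) = y := by
  have h0 : meas y Finset.univ = 0 := by
    rw [hyu, hf _ h.isSubmodularOn.univ_mem]
    exact h.isSubmodularOn.univ
  refine ⟨h.mem_gpoly_iff.2 fun S hS => ?_, extend_restrict h0⟩
  rw [extend_restrict h0, ← hf S hS]
  exact hy S

/-- The greedy base for the indicator of `T` is tight at `T`. If `pairFn` is infinite at `T`, the
extension is chosen large enough there to exceed `c`, which treats finite and infinite values
together. -/
lemma IsStrongPair.exists_lt_meas (h : IsStrongPair b a) (T : Finset (Option N)) {c : EReal}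
    (hc : c < pairFn b a T) : ∃ x ∈ gpoly b a, c < (meas (extend x) T : EReal) := by
  obtain ⟨C, hC1, hC2⟩ : ∃ C : ℝ, c < C ∧ (C : EReal) ≤ pairFn b a T := by
    obtain ⟨C, h1, h2⟩ := EReal.lt_iff_exists_real_btwn.1 hc
    exact ⟨C, h1, h2.le⟩
  obtain ⟨f, hsub, hf, hfC, -⟩ := h.isSubmodularOn.exists_extension C
  have hf0 : f ∅ = 0 := (hf _ h.isSubmodularOn.empty_mem).trans h.isSubmodularOn.empty
  obtain ⟨y, hy, hyu, htight, -, -⟩ := exists_greedy hf0 hsub (indic T)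
  obtain ⟨h1, h2⟩ := h.restrict_mem_gpoly hf hy hyu
  refine ⟨_, h1, hC1.trans_le ?_⟩
  rw [h2, htight T fun i hi j hj => by simp [indic, hi, hj], EReal.coe_le_coe_iff]
  by_cases hT : T ∈ finiteSets b a
  · rw [hf T hT, ← EReal.coe_le_coe_iff, h.coe_toReal hT]
    exact hC2
  · exact hfC T hT

lemma IsStrongPair.gpoly_nonempty (h : IsStrongPair b a) : (gpoly b a).Nonempty := by
  obtain ⟨x, hx, -⟩ := h.exists_lt_meas ∅ (c := ⊥) (bot_lt_iff_ne_bot.2 (h.pairFn_ne_bot _))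
  exact ⟨x, hx⟩

lemma IsStrongPair.upperFn_gpoly (h : IsStrongPair b a) : upperFn (gpoly b a) = b := by
  funext S
  refine le_antisymm (iSup₂_le fun x hx => (hx S).2) (le_of_forall_lt fun c hc => ?_)
  rw [← pairFn_map_some b a] at hc
  obtain ⟨x, hx, hcx⟩ := h.exists_lt_meas _ hc
  rw [meas_extend_map_some] at hcx
  exact hcx.trans_le (meas_le_upperFn hx S)

lemma IsStrongPair.lowerFn_gpoly (h : IsStrongPair b a) : lowerFn (gpoly b a) = a := by
  funext S
  refine le_antisymm (le_of_forall_gt fun c hc => ?_) (le_iInf₂ fun x hx => (hx S).1)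
  rw [← EReal.neg_lt_neg_iff, ← pairFn_insertNone_compl b a] at hc
  obtain ⟨x, hx, hcx⟩ := h.exists_lt_meas _ hc
  rw [meas_extend_insertNone_compl, EReal.coe_neg, EReal.neg_lt_neg_iff] at hcx
  exact (lowerFn_le_meas hx S).trans_lt hcx

/-- By submodularity the sets tight on all of a face are closed under union and intersection. The
tangent space is the common kernel of their functionals, and the annihilator of a ring of sets is
spanned by differences of unit vectors. -/
lemma IsStrongPair.isANPolyhedron_gpoly (h : IsStrongPair b a) : IsANPolyhedron (gpoly b a) := by
  refine ⟨h.isPolyhedron_gpoly, fun F hF => ?_⟩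
  have hFP : ∀ x ∈ F, x ∈ gpoly b a := by
    obtain ⟨-, p, rfl⟩ := hF
    exact fun x hx => hx.1
  have hg := h.isSubmodularOn
  set g : Finset (Option N) → ℝ := fun S => (pairFn b a S).toReal with hgdef
  set E : Set (Finset (Option N)) :=
    {S | S ∈ finiteSets b a ∧ ∀ x ∈ F, meas (extend x) S = g S} with hE
  have hmod : ∀ S ∈ E, ∀ T ∈ E, S ∪ T ∈ E ∧ S ∩ T ∈ E := by
    intro S hS T hT
    have hU := hg.union_mem S hS.1 T hT.1
    have hI := hg.inter_mem S hS.1 T hT.1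
    have key : ∀ x ∈ F, meas (extend x) (S ∪ T) = g (S ∪ T) ∧
        meas (extend x) (S ∩ T) = g (S ∩ T) := by
      intro x hx
      have h1 := h.mem_gpoly_iff.1 (hFP x hx) _ hU
      have h2 := h.mem_gpoly_iff.1 (hFP x hx) _ hI
      have h3 := meas_union_add_meas_inter (extend x) S T
      have h4 := hg.submodular S hS.1 T hT.1
      rw [hS.2 x hx, hT.2 x hx] at h3
      change _ ≤ g _ at h1
      change _ ≤ g _ at h2
      constructor <;> linarith
    exact ⟨⟨hU, fun x hx => (key x hx).1⟩, ⟨hI, fun x hx => (key x hx).2⟩⟩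
  refine ⟨{u | u ∈ rootsA N ∧ ∀ S ∈ E, extDual S u = 0}, fun u hu => hu.1, le_antisymm ?_ ?_⟩
  · intro v hv
    have hv0 : ∀ S ∈ E, meas (extend v) S = 0 := by
      intro S hS
      rw [← extDual_apply]
      refine map_eq_zero_of_mem_tangentSpace (F := F) (fun x hx y hy => ?_) hv
      rw [extDual_apply, extDual_apply, hS.2 x hx, hS.2 y hy]
    have hspan := mem_span_of_forall_meas_eq_zero (D := E)
      ⟨hg.empty_mem, fun x _ => by rw [hg.empty]; simp [meas]⟩
      ⟨hg.univ_mem, fun x _ => by rw [hg.univ, meas_extend_univ]⟩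
      (fun S hS T hT => (hmod S hS T hT).1) (fun S hS T hT => (hmod S hS T hT).2) hv0
    have := Submodule.mem_map_of_mem (f := restrict) hspan
    rw [restrict_extend, Submodule.map_span] at this
    refine Submodule.span_le.2 ?_ this
    rintro _ ⟨_, ⟨i, j, hij, rfl⟩, rfl⟩
    rcases restrict_single_sub_single_mem i j with h0 | hroot
    · rw [h0]; exact Submodule.zero_mem _
    · refine Submodule.subset_span ⟨hroot, fun S hS => ?_⟩
      have hmeas : ∀ S : Finset (Option N), (i ∈ S ↔ j ∈ S) →
          meas (Pi.single i 1 - Pi.single j 1 : Option N → ℝ) S = 0 := by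
        intro S hS
        simp [meas, Finset.sum_sub_distrib, Finset.sum_pi_single', hS]
      rw [extDual_restrict S (hmeas _ (by simp)), hmeas S (hij S hS)]
  · rw [Submodule.span_le]
    rintro u ⟨-, hu⟩
    rw [h.gpoly_eq_solutionSet] at hF
    refine mem_tangentSpace_of_forall_tight hF fun c hc hct => ?_
    simp only [gpolySystem, Finset.mem_image, Finset.mem_filter, Finset.mem_univ, true_and] at hc
    obtain ⟨S, hS, rfl⟩ := hc
    exact hu S ⟨hS, fun x hx => by rw [← extDual_apply]; exact hct x hx⟩

/-! ### Integrality, boundedness and the correspondence -/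

lemma IsIntegerValuedPair.exists_int (hint : IsIntegerValuedPair b a) {S : Finset (Option N)}
    (hS : S ∈ finiteSets b a) : ∃ z : ℤ, (pairFn b a S).toReal = z := by
  simp only [finiteSets, Set.mem_ofPred_eq, pairFn] at hS ⊢
  split_ifs at hS ⊢
  · rcases hint.2 (Finset.eraseNone S)ᶜ with h | ⟨z, h⟩
    · simp [h] at hS
    · exact ⟨-z, by simp [h]⟩
  · rcases hint.1 (Finset.eraseNone S) with h | ⟨z, h⟩
    · exact absurd h hS
    · exact ⟨z, by simp [h]⟩

lemma IsStrongPair.isIntegerPolyhedron_gpoly (h : IsStrongPair b a)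
    (hint : IsIntegerValuedPair b a) : IsIntegerPolyhedron (gpoly b a) := by
  classical
  constructor
  -- The coordinate at `none` is minus the sum of the others, hence the subtracted term.
  · let n : Finset (Option N) → N → ℤ := fun S i =>
      (if some i ∈ S then 1 else 0) - if none ∈ S then 1 else 0
    have hn : ∀ S x, ∑ i, (n S i : ℝ) * x i = meas (extend x) S := by
      intro S x
      have h1 : meas (extend x) S = ∑ o, indic S o * extend x o := by
        rw [← dotDual_indic, dotDual_apply]
      rw [h1, Fintype.sum_option]
      have h2 : extend x none = -∑ i, x i := rfl
      have h3 : ∀ i, extend x (some i) = x i := fun i => rfl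
      simp only [h2, h3, n, Int.cast_sub, sub_mul, Finset.sum_sub_distrib, indic, Int.cast_ite,
        Int.cast_one, Int.cast_zero]
      rw [← Finset.mul_sum]
      ring
    refine ⟨(Finset.univ.filter (· ∈ finiteSets b a)).image
      fun S => (n S, ⌊(pairFn b a S).toReal⌋), ?_⟩
    ext x
    simp only [h.mem_gpoly_iff, Finset.forall_mem_image, Finset.mem_filter, Finset.mem_univ,
      true_and, Set.mem_ofPred_eq, hn]
    refine forall₂_congr fun S hS => ?_
    obtain ⟨z, hz⟩ := hint.exists_int hS
    rw [hz, Int.floor_intCast]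
  · rintro F ⟨⟨x, hxF⟩, p, rfl⟩
    obtain ⟨hx, hmax⟩ := hxF
    -- With this `C` the extended `x` remains a base of the finite extension, so the greedy base,
    -- which is integral, is at least as good for `p` as the maximizer `x`.
    obtain ⟨C, hC⟩ := (Set.finite_range fun S => meas (extend x) S).bddAbove
    obtain ⟨f, hsub, hf, hfC, hfint⟩ := h.isSubmodularOn.exists_extension C
    have hfint := hfint fun S hS => hint.exists_int hS
    have hf0 : f ∅ = 0 := (hf _ h.isSubmodularOn.empty_mem).trans h.isSubmodularOn.empty
    set p' : Option N → ℝ := fun o => o.elim 0 fun i => p (Pi.single i 1) with hp'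
    have hpp' : ∀ y, ∑ o, p' o * y o = p (restrict y) := by
      intro y
      rw [eq_dotDual p, dotDual_apply, Fintype.sum_option]
      simp [p', restrict_apply]
    obtain ⟨y, hy, hyu, -, hopt, hyint⟩ := exists_greedy hf0 hsub p'
    obtain ⟨h1, -⟩ := h.restrict_mem_gpoly hf hy hyu
    have hle : p x ≤ p (restrict y) := by
      have := hopt (extend x) (fun S => ?_) ?_
      · rwa [hpp', hpp', restrict_extend] at this
      · by_cases hS : S ∈ finiteSets b a
        · rw [hf S hS]
          exact h.mem_gpoly_iff.1 hx S hS
        · exact (hC ⟨S, rfl⟩).trans (hfC S hS)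
      · rw [meas_extend_univ, hf _ h.isSubmodularOn.univ_mem]
        exact h.isSubmodularOn.univ.symm
    have hz : ∀ i : N, ∃ z : ℤ, (z : ℝ) = restrict y i := by
      intro i
      obtain ⟨S, T, hST⟩ := hyint (some i)
      obtain ⟨z, hz⟩ := hfint S
      obtain ⟨w, hw⟩ := hfint T
      exact ⟨z - w, by rw [restrict_apply, hST, hz, hw, Int.cast_sub]⟩
    choose z hz using hz
    refine ⟨z, ?_⟩
    rw [show (fun i => (z i : ℝ)) = restrict y from funext hz]
    exact ⟨h1, fun w hw => (hmax w hw).trans hle⟩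

/-- A finite extremal value of `x(S)` is attained on a face, and that face contains an integer
point. -/
lemma IsIntegerPolyhedron.isIntegerValuedPair {P : Set (N → ℝ)} (hP : IsIntegerPolyhedron P)
    (hpoly : IsPolyhedron P) (hne : P.Nonempty) :
    IsIntegerValuedPair (upperFn P) (lowerFn P) := by
  have hcast : ∀ (z : N → ℤ) (S : Finset N), meas (fun i => (z i : ℝ)) S = (∑ i ∈ S, z i : ℤ) := by
    intro z S
    simp [meas]
  refine ⟨fun S => or_iff_not_imp_left.2 fun hS => ?_, fun S => or_iff_not_imp_left.2 fun hS => ?_⟩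
  · obtain ⟨C, hC⟩ := exists_meas_le_of_upperFn_ne_top hne hS
    obtain ⟨z, hz, hmax⟩ := hP.exists_int_of_bddAbove hpoly hne (p := dotDual (indic S))
      ⟨C, by rintro _ ⟨x, hx, rfl⟩; rw [dotDual_indic]; exact hC x hx⟩
    simp only [dotDual_indic] at hmax
    exact ⟨_, by rw [upperFn_eq hz hmax, hcast]⟩
  · obtain ⟨C, hC⟩ := exists_le_meas_of_lowerFn_ne_bot hne hS
    obtain ⟨z, hz, hmax⟩ := hP.exists_int_of_bddAbove hpoly hne (p := dotDual (-indic S))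
      ⟨-C, by
        rintro _ ⟨x, hx, rfl⟩
        rw [dotDual_neg, dotDual_indic]
        exact neg_le_neg (hC x hx)⟩
    simp only [dotDual_neg, dotDual_indic, neg_le_neg_iff] at hmax
    exact ⟨_, by rw [lowerFn_eq hz hmax, hcast]⟩

lemma IsStrongPair.isIntegerPolyhedron_gpoly_iff (h : IsStrongPair b a) :
    IsIntegerPolyhedron (gpoly b a) ↔ IsIntegerValuedPair b a := by
  refine ⟨fun hP => ?_, h.isIntegerPolyhedron_gpoly⟩
  simpa only [h.upperFn_gpoly, h.lowerFn_gpoly] using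
    hP.isIntegerValuedPair h.isPolyhedron_gpoly h.gpoly_nonempty

lemma IsStrongPair.isBounded_gpoly_iff (h : IsStrongPair b a) :
    Bornology.IsBounded (gpoly b a) ↔ ∀ S, b S ≠ ⊤ ∧ a S ≠ ⊥ := by
  constructor
  · intro hb S
    obtain ⟨R, hR⟩ := hb.exists_norm_le
    have hbound : ∀ x ∈ gpoly b a, |meas x S| ≤ ∑ _i ∈ S, R := fun x hx =>
      (Finset.abs_sum_le_sum_abs _ _).trans <| Finset.sum_le_sum fun i _ =>
        (norm_le_pi_norm x i).trans (hR x hx)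
    constructor
    · rw [← h.upperFn_gpoly]
      refine ne_top_of_le_ne_top (EReal.coe_ne_top (∑ _i ∈ S, R)) (iSup₂_le fun x hx => ?_)
      exact EReal.coe_le_coe_iff.2 ((le_abs_self _).trans (hbound x hx))
    · rw [← h.lowerFn_gpoly]
      refine ne_bot_of_le_ne_bot (EReal.coe_ne_bot (-∑ _i ∈ S, R)) (le_iInf₂ fun x hx => ?_)
      exact EReal.coe_le_coe_iff.2 (neg_le_of_abs_le (hbound x hx))
  · intro hfin
    -- The constraints on singletons already confine the set to a box.
    refine (Metric.isBounded_Icc (fun i => (a {i}).toReal) fun i => (b {i}).toReal).subset ?_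
    refine fun x hx => ⟨fun i => ?_, fun i => ?_⟩
    · have := (hx {i}).1
      rw [← EReal.coe_toReal (h.a_ne_top _) (hfin _).2, EReal.coe_le_coe_iff] at this
      simpa [meas] using this
    · have := (hx {i}).2
      rw [← EReal.coe_toReal (hfin _).1 (h.b_ne_bot _), EReal.coe_le_coe_iff] at this
      simpa [meas] using this

lemma isGPolymatroid_iff {P : Set (N → ℝ)} : IsGPolymatroid P ↔ P.Nonempty ∧ IsANPolyhedron P := by
  constructor
  · rintro ⟨b, a, h, rfl⟩
    exact ⟨h.gpoly_nonempty, h.isANPolyhedron_gpoly⟩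
  · rintro ⟨hne, hP⟩
    exact ⟨_, _, hP.isStrongPair hne, (hP.gpoly_eq hne).symm⟩

lemma isIntegerGPolymatroid_iff {P : Set (N → ℝ)} :
    IsIntegerGPolymatroid P ↔ P.Nonempty ∧ IsANPolyhedron P ∧ IsIntegerPolyhedron P := by
  constructor
  · rintro ⟨b, a, h, hint, rfl⟩
    exact ⟨h.gpoly_nonempty, h.isANPolyhedron_gpoly, h.isIntegerPolyhedron_gpoly hint⟩
  · rintro ⟨hne, hP, hint⟩
    exact ⟨_, _, hP.isStrongPair hne, hint.isIntegerValuedPair hP.1 hne, (hP.gpoly_eq hne).symm⟩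

lemma isANPolytope_iff {P : Set (N → ℝ)} :
    IsANPolytope P ↔ IsANPolyhedron P ∧ Bornology.IsBounded P :=
  ⟨fun h => ⟨h.2, h.1.isBounded⟩, fun h => ⟨h.1.1.isPolytope h.2, h.1⟩⟩

end StrongPairs

end DiscreteConvexity

open DiscreteConvexity in
theorem mainTheorem6 (N : Type*) [Fintype N] [DecidableEq N] :
    -- generalized polymatroids are exactly the non-empty `𝔸_N`-polyhedra
    (∀ P : Set (N → ℝ), IsGPolymatroid P ↔ P.Nonempty ∧ IsANPolyhedron P) ∧
    -- bounded generalized polymatroids are exactly the non-empty `𝔸_N`-polytopes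
    (∀ P : Set (N → ℝ), (IsGPolymatroid P ∧ Bornology.IsBounded P) ↔
      P.Nonempty ∧ IsANPolytope P) ∧
    -- integer generalized polymatroids are exactly the non-empty integer `𝔸_N`-polyhedra
    (∀ P : Set (N → ℝ), IsIntegerGPolymatroid P ↔
      P.Nonempty ∧ IsANPolyhedron P ∧ IsIntegerPolyhedron P) ∧
    -- bounded integer ones are exactly the non-empty integer `𝔸_N`-polytopes
    (∀ P : Set (N → ℝ), (IsIntegerGPolymatroid P ∧ Bornology.IsBounded P) ↔
      P.Nonempty ∧ IsANPolytope P ∧ IsIntegerPolyhedron P) ∧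
    -- the correspondence: from polyhedra to strong pairs
    (∀ P : Set (N → ℝ), P.Nonempty → IsANPolyhedron P →
      IsStrongPair (upperFn P) (lowerFn P) ∧ gpoly (upperFn P) (lowerFn P) = P) ∧
    -- and back, with bounded polyhedra matching finite pairs and integer ones integer pairs
    (∀ b a : Finset N → EReal, IsStrongPair b a →
      upperFn (gpoly b a) = b ∧ lowerFn (gpoly b a) = a ∧
      (Bornology.IsBounded (gpoly b a) ↔ ∀ S, b S ≠ ⊤ ∧ a S ≠ ⊥) ∧
      (IsIntegerPolyhedron (gpoly b a) ↔ IsIntegerValuedPair b a)) := by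
  refine ⟨fun P => isGPolymatroid_iff, fun P => ?_, fun P => isIntegerGPolymatroid_iff,
    fun P => ?_, fun P hne hP => ⟨hP.isStrongPair hne, hP.gpoly_eq hne⟩,
    fun b a h => ⟨h.upperFn_gpoly, h.lowerFn_gpoly, h.isBounded_gpoly_iff,
      h.isIntegerPolyhedron_gpoly_iff⟩⟩
  · rw [isGPolymatroid_iff, isANPolytope_iff, and_assoc]
  · rw [isIntegerGPolymatroid_iff, isANPolytope_iff]
    tauto
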